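/- All graphs are finite and simple, and $\mathrm{dist}_G$ is the graph distance. A graph is \emph{outerplanar} if it has a crossing-free (straight-line) drawing in the plane such that all its vertices lie on the boundary of the outer (unbounded) face; such a drawing is called outerplane. It is \emph{maximal outerplanar} if it is outerplanar and no edge can be added to it such that the resulting graph is still outerplanar; in an outerplane drawing of such a graph with at least three vertices, the bounded faces are triangles. For a maximal outerplanar graph $G=(V,E)$ with an outerplane drawing: A set $F\subseteq V$ is a \emph{$2d$-guarding set} if every bounded (triangular) face has a vertex $x$ with $\mathrm{dist}_G(x,p)\le 1$ for some $p\in F$; the $2d$-guarding number $g_{2d}(G)$ is the size of a smallest $2d$-guarding set. A set $D\subseteq V$ is a \emph{$2d$-dominating set} if every vertex $u\in V\setminus D$ satisfies $\mathrm{dist}_G(u,v)\le 2$ for some $v\in D$; the $2d$-domination number $\gamma_{2d}(G)$ is the size of a smallest $2d$-dominating set. Let $g_{2d}(n)$ and $\gamma_{2d}(n)$ be the maximum of $g_{2d}(G)$ and of $\gamma_{2d}(G)$, respectively, over all maximal outerplanar graphs $G$ with $n$ vertices. \textbf{Theorem.} Let $n\ge 5$. Every $n$-vertex maximal outerplanar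 graph has a $2d$-guarding set of $\lfloor n/5\rfloor$ vertices (for every outerplane drawing) and a $2d$-dominating set of $\lfloor n/5\rfloor$ vertices. This bound is tight in the worst case, for guarding as well as for domination and for every $n\ge 5$; that is, $$g_{2d}(n)=\gamma_{2d}(n)=\left\lfloor \tfrac n5\right\rfloor .$$ -/

import Mathlib

/-- A crossing-free straight-line drawing of `G` in the Euclidean plane: distinct vertices are
placed at distinct points, an edge is drawn as the segment joining its endpoints, no vertex lies
on an edge of which it is not an endpoint, and two distinct edges meet at most in common
endpoints. -/
structure PlaneDrawing {V : Type*} (G : SimpleGraph V) where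
  pos : V → EuclideanSpace ℝ (Fin 2)
  injective : Function.Injective pos
  vertex_notMem : ∀ u v w : V, G.Adj u v → w ≠ u → w ≠ v →
    pos w ∉ segment ℝ (pos u) (pos v)
  crossing_free : ∀ u v w x : V, G.Adj u v → G.Adj w x → s(u, v) ≠ s(w, x) →
    Disjoint (openSegment ℝ (pos u) (pos v)) (openSegment ℝ (pos w) (pos x))

namespace PlaneDrawing

/-- The set of points of the plane covered by the drawing (vertices and edges). -/
def support {V : Type*} {G : SimpleGraph V} (d : PlaneDrawing G) :
    Set (EuclideanSpace ℝ (Fin 2)) :=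
  Set.range d.pos ∪ {p | ∃ u v : V, G.Adj u v ∧ p ∈ segment ℝ (d.pos u) (d.pos v)}

/-- The outer face: the points of the plane off the drawing whose connected component in the
complement of the drawing is unbounded. -/
def outerFace {V : Type*} {G : SimpleGraph V} (d : PlaneDrawing G) :
    Set (EuclideanSpace ℝ (Fin 2)) :=
  {p | p ∈ d.supportᶜ ∧ ¬ Bornology.IsBounded (connectedComponentIn d.supportᶜ p)}

/-- All vertices lie on the boundary of the outer face. -/
def IsOuterplane {V : Type*} {G : SimpleGraph V} (d : PlaneDrawing G) : Prop :=
  ∀ v : V, d.pos v ∈ frontier d.outerFace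

/-- The vertices `a`, `b`, `c` bound a triangular face of the drawing: they are pairwise adjacent
and no vertex or edge enters the interior of the triangle that they span. (All bounded faces of a
maximal outerplanar graph, drawn with all vertices on the outer face, are of this kind.) -/
def IsTriangle {V : Type*} {G : SimpleGraph V} (d : PlaneDrawing G) (a b c : V) : Prop :=
  G.Adj a b ∧ G.Adj b c ∧ G.Adj a c ∧
    Disjoint (interior (convexHull ℝ {d.pos a, d.pos b, d.pos c})) d.support

/-- `F` is a `kd`-guarding set: every triangle has a vertex at distance at most `k - 1` from some
element of `F`. (The distance is `⊤` between vertices that no walk joins.) -/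
def IsGuardingSet {V : Type*} {G : SimpleGraph V} (d : PlaneDrawing G) (k : ℕ)
    (F : Finset V) : Prop :=
  ∀ a b c : V, d.IsTriangle a b c →
    ∃ p ∈ F, ∃ x : V, (x = a ∨ x = b ∨ x = c) ∧ G.edist x p + 1 ≤ (k : ℕ∞)

/-- The `kd`-guarding number: the size of a smallest `kd`-guarding set. -/
noncomputable def guardingNumber {V : Type*} {G : SimpleGraph V} (d : PlaneDrawing G)
    (k : ℕ) : ℕ :=
  sInf {m | ∃ F : Finset V, d.IsGuardingSet k F ∧ F.card = m}

end PlaneDrawing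

namespace SimpleGraph

/-- `G` has a crossing-free drawing with all vertices on the boundary of the outer face. -/
def IsOuterplanar {V : Type*} (G : SimpleGraph V) : Prop :=
  ∃ d : PlaneDrawing G, d.IsOuterplane

/-- `G` is outerplanar and no edge can be added to it such that the resulting graph is still
outerplanar. -/
def IsMaximalOuterplanar {V : Type*} (G : SimpleGraph V) : Prop :=
  G.IsOuterplanar ∧
    ∀ u v : V, u ≠ v → ¬ G.Adj u v → ¬ (G ⊔ SimpleGraph.edge u v).IsOuterplanar

/-- `D` is a `kd`-dominating (distance `k`-dominating) set: every vertex outside `D` is at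
distance at most `k` from some element of `D`. -/
def IsDistDominatingSet {V : Type*} (G : SimpleGraph V) (k : ℕ) (D : Finset V) : Prop :=
  ∀ u : V, u ∉ D → ∃ v ∈ D, G.edist u v ≤ (k : ℕ∞)

/-- The `kd`-domination number: the size of a smallest `kd`-dominating set. -/
noncomputable def distDominationNumber {V : Type*} (G : SimpleGraph V) (k : ℕ) : ℕ :=
  sInf {m | ∃ D : Finset V, G.IsDistDominatingSet k D ∧ D.card = m}

end SimpleGraph

/-- The `kd`-guarding numbers of the `n`-vertex maximal outerplanar graphs, drawn with all
vertices on the outer face; `g_{kd}(n)` is the maximum of this set. -/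
def guardingNumbersMOP (k n : ℕ) : Set ℕ :=
  {m | ∃ (G : SimpleGraph (Fin n)) (d : PlaneDrawing G),
    G.IsMaximalOuterplanar ∧ d.IsOuterplane ∧ d.guardingNumber k = m}

/-- The `kd`-domination numbers of the `n`-vertex maximal outerplanar graphs; `γ_{kd}(n)` is the
maximum of this set. -/
def dominationNumbersMOP (k n : ℕ) : Set ℕ :=
  {m | ∃ G : SimpleGraph (Fin n),
    G.IsMaximalOuterplanar ∧ G.distDominationNumber k = m}

/-! Upper bound. The vertices are coloured with five colours such that, for each triangle, the
closed neighbourhoods of its three vertices together contain all five colours. A smallest colour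
class then has at most `n / 5` vertices and meets the neighbourhood of every triangle. It also
dominates at distance two, since every vertex lies in a triangle. The colouring starts with five
distinct colours on a pentagon and grows by one ear at a time. The invariant `IsGoodColouring` asks
that each end of a boundary edge sees at least three colours and both ends together at least four;
by `exists_colour` this is just enough to colour the next ear and to restore the invariant
(`IsGoodColouring.exists_insert`).

This needs a maximal outerplanar graph to be a triangulated polygon, although outerplanarity is
defined by arbitrary drawings. Geometry enters once: a closed walk does not wind around a vertex
that it avoids, because that vertex borders the outer face. Hence an outerplanar graph has no triad
(`IsOuterplanar.noTriad`). The rest is combinatorial: a graph without triads has a circular vertex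
order without crossing edges (`NoTriad.exists_nonCrossing`). Conversely, placing such an order on a
parabola gives an outerplane drawing, so in a maximal graph every missing chord is crossed by an
edge.

Lower bound. In `blockGraph` each of `n / 5` disjoint pentagons contains a vertex whose ball of
radius two stays inside the pentagon, so each needs its own guard. Its maximality must hold against
all drawings; `NoTriad.nonCrossing_of_cycle` provides this, as it forbids crossing chords of a
Hamiltonian cycle. -/

namespace PlaneDrawing

/-! ### Winding of walks around points of an outerplane drawing. -/

open Filter Topology

/-- The Euclidean plane as the complex plane. -/
noncomputable def toComplex : EuclideanSpace ℝ (Fin 2) ≃ₗᵢ[ℝ] ℂ :=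
  Complex.orthonormalBasisOneI.repr.symm

/-- The vector from `p` to `q`, as a complex number. -/
noncomputable def vec (p q : EuclideanSpace ℝ (Fin 2)) : ℂ :=
  toComplex (q - p)

lemma continuous_vec_left (q : EuclideanSpace ℝ (Fin 2)) : Continuous fun p => vec p q := by
  unfold vec; fun_prop

lemma vec_eq_zero {p q : EuclideanSpace ℝ (Fin 2)} : vec p q = 0 ↔ q = p := by
  simp [vec, sub_eq_zero]

lemma norm_vec (p q : EuclideanSpace ℝ (Fin 2)) : ‖vec p q‖ = ‖q - p‖ := by
  rw [vec, LinearIsometryEquiv.norm_map]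

/-- The oriented angle in `(-π, π]` under which the segment from `u` to `v` is seen from `q`. -/
noncomputable def turn (q u v : EuclideanSpace ℝ (Fin 2)) : ℝ :=
  (vec q v / vec q u).arg

lemma exists_of_notMem_slitPlane {z w : ℂ} (hw : w ≠ 0) (h : z / w ∉ Complex.slitPlane) :
    ∃ r : ℝ, 0 ≤ r ∧ z + r * w = 0 := by
  rw [Complex.mem_slitPlane_iff] at h
  push Not at h
  refine ⟨-(z / w).re, by linarith [h.1], ?_⟩
  have h1 : z / w = ((z / w).re : ℂ) := Complex.ext rfl (by simpa using h.2)
  have h2 : z = (z / w) * w := by field_simp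
  push_cast
  rw [← h1, neg_mul, ← h2]
  ring

/-- The quotient is a nonpositive real only when `u` and `v` lie in opposite directions from `q`,
and then `q` lies between them. Thus `turn` jumps only on the segment. -/
lemma div_mem_slitPlane {q u v : EuclideanSpace ℝ (Fin 2)} (h : q ∉ segment ℝ u v) :
    vec q v / vec q u ∈ Complex.slitPlane := by
  have hu : vec q u ≠ 0 := fun h0 => h (vec_eq_zero.1 h0 ▸ left_mem_segment ℝ u v)
  by_contra hs
  obtain ⟨r, hr, h0⟩ := exists_of_notMem_slitPlane hu hs
  have h1 : (v - q) + r • (u - q) = 0 := by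
    apply toComplex.injective
    simpa [vec] using h0
  refine h ⟨r / (1 + r), 1 / (1 + r), by positivity, by positivity, by field_simp; ring, ?_⟩
  have h2 : r • u + v = (1 + r) • q := by
    rw [← sub_eq_zero, ← h1]; module
  have h3 : (r / (1 + r)) • u + (1 / (1 + r)) • v = (1 / (1 + r)) • (r • u + v) := by
    rw [smul_add, smul_smul]; congr 2; field_simp
  rw [h3, h2, smul_smul]
  field_simp
  simp

lemma continuousAt_turn {q u v : EuclideanSpace ℝ (Fin 2)} (h : q ∉ segment ℝ u v) :
    ContinuousAt (fun p => turn p u v) q := by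
  have hu : vec q u ≠ 0 := fun h0 => h (vec_eq_zero.1 h0 ▸ left_mem_segment ℝ u v)
  exact ContinuousAt.comp (f := fun p => vec p v / vec p u)
    (Complex.continuousAt_arg (div_mem_slitPlane h))
    ((continuous_vec_left v).continuousAt.div (continuous_vec_left u).continuousAt hu)

/-- The quotient of the two vectors equals `1 + vec u v / vec p u`, which tends to `1`. -/
lemma tendsto_turn_cobounded (u v : EuclideanSpace ℝ (Fin 2)) :
    Tendsto (fun p => turn p u v) (Bornology.cobounded _) (𝓝 0) := by
  have h1 : Tendsto (fun p => vec p u) (Bornology.cobounded _) (Bornology.cobounded ℂ) := by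
    rw [← tendsto_norm_atTop_iff_cobounded]
    simp only [norm_vec]
    have := tendsto_norm_cobounded_atTop (E := EuclideanSpace ℝ (Fin 2))
    refine tendsto_atTop_mono (f := fun p => ‖p‖ - ‖u‖) (fun p => ?_)
      (tendsto_atTop_add_const_right _ _ this)
    rw [norm_sub_rev]
    exact norm_sub_norm_le p u
  have h2 : Tendsto (fun p => 1 + vec u v * (vec p u)⁻¹) (Bornology.cobounded _) (𝓝 1) := by
    have := (tendsto_inv₀_cobounded.comp h1).const_mul (vec u v)
    simpa using this.const_add 1
  have h3 : Tendsto (fun p => (1 + vec u v * (vec p u)⁻¹).arg) (Bornology.cobounded _) (𝓝 0) := by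
    have := (Complex.continuousAt_arg (x := 1) (by simp)).tendsto.comp h2
    simpa [Function.comp_def] using this
  refine h3.congr' ?_
  have h4 : ∀ᶠ p in Bornology.cobounded (EuclideanSpace ℝ (Fin 2)), vec p u ≠ 0 := by
    have := h1.eventually (Bornology.eventually_ne_cobounded 0)
    exact this
  filter_upwards [h4] with p hp
  unfold turn
  congr 1
  have : vec p v = vec p u + vec u v := by simp [vec]
  rw [this, add_div, div_self hp, div_eq_mul_inv]

lemma coe_turn {q u v : EuclideanSpace ℝ (Fin 2)} (hu : u ≠ q) (hv : v ≠ q) :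
    (turn q u v : Real.Angle) = (vec q v).arg - (vec q u).arg :=
  Complex.arg_div_coe_angle (fun h => hv (vec_eq_zero.1 h)) (fun h => hu (vec_eq_zero.1 h))

variable {V : Type*} {G : SimpleGraph V} (d : PlaneDrawing G)

/-- The total angle swept by a walk as seen from `q`. -/
noncomputable def sweep (q : EuclideanSpace ℝ (Fin 2)) {u v : V} (w : G.Walk u v) : ℝ :=
  (w.darts.map fun e => turn q (d.pos e.fst) (d.pos e.snd)).sum

@[simp] lemma sweep_cons (q : EuclideanSpace ℝ (Fin 2)) {u v w : V} (h : G.Adj u v)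
    (p : G.Walk v w) :
    d.sweep q (SimpleGraph.Walk.cons h p) = turn q (d.pos u) (d.pos v) + d.sweep q p := by
  simp [sweep]

@[simp] lemma sweep_nil (q : EuclideanSpace ℝ (Fin 2)) (u : V) :
    d.sweep q (SimpleGraph.Walk.nil : G.Walk u u) = 0 := by
  simp [sweep]

@[simp] lemma sweep_append (q : EuclideanSpace ℝ (Fin 2)) {u v w : V} (p : G.Walk u v)
    (p' : G.Walk v w) : d.sweep q (p.append p') = d.sweep q p + d.sweep q p' := by
  simp [sweep]

/-- The point `q` lies on none of the edges of the walk. -/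
def OffWalk (q : EuclideanSpace ℝ (Fin 2)) {u v : V} (w : G.Walk u v) : Prop :=
  ∀ e ∈ w.darts, q ∉ segment ℝ (d.pos e.fst) (d.pos e.snd)

variable {d}

lemma continuousAt_sweep {q : EuclideanSpace ℝ (Fin 2)} {u v : V} (w : G.Walk u v)
    (h : d.OffWalk q w) : ContinuousAt (fun p => d.sweep p w) q := by
  induction w with
  | nil => simpa using continuousAt_const
  | cons hadj p ih =>
    simp only [sweep_cons]
    exact (continuousAt_turn (h ⟨(_, _), hadj⟩ (by simp))).add (ih fun e he => h e (by simp [he]))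

lemma tendsto_sweep_cobounded {u v : V} (w : G.Walk u v) :
    Tendsto (fun p => d.sweep p w) (Bornology.cobounded _) (𝓝 0) := by
  induction w with
  | nil => simp
  | cons hadj p ih =>
    simp only [sweep_cons]
    simpa using (tendsto_turn_cobounded _ _).add ih

lemma coe_sweep {q : EuclideanSpace ℝ (Fin 2)} {u v : V} (w : G.Walk u v)
    (h : d.OffWalk q w) :
    (d.sweep q w : Real.Angle) = (vec q (d.pos v)).arg - (vec q (d.pos u)).arg := by
  induction w with
  | nil => simp
  | cons hadj p ih =>
    rename_i x y _
    have h1 : q ∉ segment ℝ (d.pos x) (d.pos y) := h ⟨(_, _), hadj⟩ (by simp)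
    rw [sweep_cons, Real.Angle.coe_add, ih fun e he => h e (by simp [he]),
      coe_turn (q := q) (u := d.pos x) (v := d.pos y) (fun h0 => h1 (h0 ▸ left_mem_segment ℝ _ _))
        (fun h0 => h1 (h0 ▸ right_mem_segment ℝ _ _))]
    abel

lemma exists_sweep_eq {q : EuclideanSpace ℝ (Fin 2)} {u : V} (w : G.Walk u u)
    (h : d.OffWalk q w) : ∃ k : ℤ, d.sweep q w = 2 * Real.pi * k := by
  have := coe_sweep w h
  rw [sub_self, ← Real.Angle.coe_zero, Real.Angle.angle_eq_iff_two_pi_dvd_sub] at this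
  simpa using this

/-- The sweep of a closed walk is continuous and takes values in the discrete set of multiples of
`2π`. -/
lemma sweep_eq_of_isPreconnected {S : Set (EuclideanSpace ℝ (Fin 2))} (hS : IsPreconnected S)
    {u : V} (w : G.Walk u u) (h : ∀ q ∈ S, d.OffWalk q w) {p q : EuclideanSpace ℝ (Fin 2)}
    (hp : p ∈ S) (hq : q ∈ S) : d.sweep p w = d.sweep q w := by
  have hc : ContinuousOn (fun p => d.sweep p w / (2 * Real.pi)) S := fun q hq =>
    ((continuousAt_sweep w (h q hq)).div_const _).continuousWithinAt
  have hm : Set.MapsTo (fun p => d.sweep p w / (2 * Real.pi)) S (Set.range ((↑) : ℤ → ℝ)) := by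
    intro q hq
    obtain ⟨k, hk⟩ := exists_sweep_eq w (h q hq)
    refine ⟨k, ?_⟩
    simp only [hk]
    field_simp
  have hd : IsDiscrete (Set.range ((↑) : ℤ → ℝ)) :=
    Int.isClosedEmbedding_coe_real.isEmbedding.isDiscrete_range
  obtain ⟨y, -, hy⟩ := hS.eqOn_const_of_mapsTo hd hc hm ⟨0, 0, by simp⟩
  have h1 := (hy hp).trans (hy hq).symm
  have : (2 * Real.pi) ≠ 0 := by positivity
  field_simp at h1
  exact h1

lemma offWalk_of_mem_compl_support {q : EuclideanSpace ℝ (Fin 2)} (hq : q ∈ d.supportᶜ) {u v : V}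
    (w : G.Walk u v) : d.OffWalk q w :=
  fun e _ he => hq (Or.inr ⟨e.fst, e.snd, e.adj, he⟩)

/-- The component is unbounded, so it contains points so far away that the sweep is below `2π` in
absolute value. There it is zero, and it is constant on the component. -/
lemma sweep_eq_zero_of_mem_outerFace {q : EuclideanSpace ℝ (Fin 2)} (hq : q ∈ d.outerFace) {u : V}
    (w : G.Walk u u) : d.sweep q w = 0 := by
  obtain ⟨hq, hb⟩ := hq
  set U := connectedComponentIn d.supportᶜ q
  have hU : ∀ p ∈ U, d.OffWalk p w := fun p hp =>
    offWalk_of_mem_compl_support (connectedComponentIn_subset _ _ hp) w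
  have hqU : q ∈ U := mem_connectedComponentIn hq
  have hev : ∀ᶠ p in Bornology.cobounded _, |d.sweep p w| < 2 * Real.pi := by
    have := (tendsto_sweep_cobounded (d := d) w).abs
    rw [abs_zero] at this
    exact this.eventually_lt_const (by positivity)
  rw [Bornology.isBounded_def] at hb
  have hfr : ∃ᶠ p in Bornology.cobounded _, p ∈ U := hb
  obtain ⟨p, hpU, hp⟩ := (hfr.and_eventually hev).exists
  rw [sweep_eq_of_isPreconnected isPreconnected_connectedComponentIn w hU hqU hpU]
  obtain ⟨k, hk⟩ := exists_sweep_eq w (hU p hpU)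
  rw [hk, abs_mul, abs_of_pos (by positivity : 0 < 2 * Real.pi)] at hp
  have h1 : |(k : ℝ)| < 1 := by
    by_contra hcon
    push Not at hcon
    nlinarith [Real.pi_pos]
  have h2 : k = 0 := by
    rw [← Int.abs_lt_one_iff]
    exact_mod_cast h1
  simp [hk, h2]

lemma offWalk_pos {a u v : V} (w : G.Walk u v) (ha : a ∉ w.support) : d.OffWalk (d.pos a) w :=
  fun e he => d.vertex_notMem _ _ _ e.adj
    (fun h => ha (h ▸ w.dart_fst_mem_support_of_mem_darts he))
    (fun h => ha (h ▸ w.dart_snd_mem_support_of_mem_darts he))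

/-- In an outerplane drawing no closed walk winds around a vertex which it avoids. -/
lemma IsOuterplane.sweep_eq_zero (hd : d.IsOuterplane) {a u : V} (w : G.Walk u u)
    (ha : a ∉ w.support) : d.sweep (d.pos a) w = 0 := by
  -- The vertex is a limit of points of the outer face, and the sweep is continuous there because
  -- the walk avoids the vertex.
  have hc := continuousAt_sweep w (offWalk_pos (d := d) w ha)
  have hcl := frontier_subset_closure (hd a)
  have h1 := hc.continuousWithinAt.mem_closure_image hcl
  have h2 : (fun p => d.sweep p w) '' d.outerFace ⊆ {0} := by
    rintro _ ⟨p, hp, rfl⟩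
    exact sweep_eq_zero_of_mem_outerFace hp w
  simpa using closure_minimal h2 isClosed_singleton h1

/-- This lets an observer slide along the edge from `x` towards `a` without meeting a closed walk
that passes through `a` but avoids `x`. -/
lemma notMem_segment_of_mem {a x u v : V} (hax : G.Adj a x) (huv : G.Adj u v) (hu : u ≠ x)
    (hv : v ≠ x) {t : ℝ} (ht : t ∈ Set.Ioc (0 : ℝ) 1) :
    d.pos a + t • (d.pos x - d.pos a) ∉ segment ℝ (d.pos u) (d.pos v) := by
  rcases ht.2.eq_or_lt with rfl | h1
  · simpa using d.vertex_notMem u v x huv hu.symm hv.symm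
  have hne : d.pos a ≠ d.pos x := fun h => hax.ne (d.injective h)
  have hz : d.pos a + t • (d.pos x - d.pos a) ∈ openSegment ℝ (d.pos a) (d.pos x) :=
    ⟨1 - t, t, by linarith, ht.1, by ring, by module⟩
  have hvert : ∀ y : V, y ≠ x → d.pos a + t • (d.pos x - d.pos a) ≠ d.pos y := by
    intro y hy h
    rw [h] at hz
    rcases eq_or_ne y a with rfl | hya
    · exact hne (left_mem_openSegment_iff.1 hz)
    · exact d.vertex_notMem a x y hax hya hy (openSegment_subset_segment ℝ _ _ hz)
  intro hs
  rw [← insert_endpoints_openSegment] at hs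
  rcases hs with h | h | h
  · exact hvert u hu h
  · exact hvert v hv h
  · refine (d.crossing_free a x u v hax huv ?_).ne_of_mem hz h rfl
    intro h
    have : x ∈ s(u, v) := h ▸ Sym2.mem_mk_right a x
    rw [Sym2.mem_iff] at this
    exact this.elim (fun h => hu h.symm) (fun h => hv h.symm)

/-- Two edges cannot leave `a` in the same direction, for the nearer endpoint would lie on the other
edge. This makes the arguments in `IsOuterplane.sweep_add` continuous in the limit. -/
lemma neg_div_mem_slitPlane {a x y : V} (hx : G.Adj a x) (hy : G.Adj a y) (hxy : x ≠ y) :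
    -vec (d.pos a) (d.pos x) / vec (d.pos a) (d.pos y) ∈ Complex.slitPlane := by
  have hy0 : vec (d.pos a) (d.pos y) ≠ 0 := fun h => hy.ne (d.injective (vec_eq_zero.1 h)).symm
  by_contra hs
  obtain ⟨r, hr, h0⟩ := exists_of_notMem_slitPlane hy0 hs
  have h1 : d.pos x - d.pos a = r • (d.pos y - d.pos a) := by
    apply toComplex.injective
    have : vec (d.pos a) (d.pos x) = r * vec (d.pos a) (d.pos y) := by linear_combination -h0
    simpa [vec] using this
  rcases hr.eq_or_lt with rfl | hr
  · rw [zero_smul, sub_eq_zero] at h1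
    exact hx.ne (d.injective h1).symm
  rcases le_total r 1 with h | h
  · refine d.vertex_notMem a y x hy hx.ne.symm hxy ⟨1 - r, r, by linarith, hr.le, by ring, ?_⟩
    rw [eq_add_of_sub_eq h1]; module
  · refine d.vertex_notMem a x y hx hy.ne.symm hxy.symm
      ⟨1 - r⁻¹, r⁻¹, by simpa using inv_le_one_of_one_le₀ h, by positivity, by ring, ?_⟩
    have h2 : d.pos y - d.pos a = r⁻¹ • (d.pos x - d.pos a) := by
      rw [h1, smul_smul, inv_mul_cancel₀ hr.ne', one_smul]
    rw [eq_add_of_sub_eq h2]; module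

/-- The angle swept around `a` by a walk between two neighbours of `a` that avoids `a` and a third
neighbour `z` of `a`. -/
lemma IsOuterplane.sweep_add (hd : d.IsOuterplane) {a x y z : V} (hx : G.Adj a x) (hy : G.Adj a y)
    (hz : G.Adj a z) (w : G.Walk x y) (hwa : a ∉ w.support) (hwz : z ∉ w.support) :
    d.sweep (d.pos a) w + (-vec (d.pos a) (d.pos x) / vec (d.pos a) (d.pos z)).arg +
      (-vec (d.pos a) (d.pos z) / vec (d.pos a) (d.pos y)).arg = 0 := by
  have hxz : x ≠ z := fun h => hwz (h ▸ w.start_mem_support)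
  have hyz : y ≠ z := fun h => hwz (h ▸ w.end_mem_support)
  let p : ℝ → EuclideanSpace ℝ (Fin 2) := fun t => d.pos a + t • (d.pos z - d.pos a)
  have hp : Continuous p := by fun_prop
  have hp0 : p 0 = d.pos a := by simp [p]
  have hp1 : p 1 = d.pos z := by simp [p]
  -- `w` is closed up through `a` and observed from the points `p t` of the edge `az`. From `z`, at
  -- `t = 1`, the sweep is zero, and it stays zero for all `t > 0`.
  let C : G.Walk a a := .cons hx (w.append (.cons hy.symm .nil))
  have hCz : z ∉ C.support := by
    simp [C, SimpleGraph.Walk.mem_support_append_iff, hz.ne.symm, hwz, hyz.symm]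
  have hoff : ∀ q ∈ p '' Set.Ioc 0 1, d.OffWalk q C := by
    rintro _ ⟨t, ht, rfl⟩ e he
    exact notMem_segment_of_mem hz e.adj
      (fun h => hCz (h ▸ C.dart_fst_mem_support_of_mem_darts he))
      (fun h => hCz (h ▸ C.dart_snd_mem_support_of_mem_darts he)) ht
  have hC : ∀ t ∈ Set.Ioc (0 : ℝ) 1, d.sweep (p t) C = 0 := by
    intro t ht
    rw [← hd.sweep_eq_zero C hCz]
    refine sweep_eq_of_isPreconnected (isPreconnected_Ioc.image p hp.continuousOn) C hoff
      (Set.mem_image_of_mem p ht) ⟨1, by simp, hp1⟩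
  -- For `t > 0` this is the sweep of `C`: seen from `p t`, the vertex `a` lies in the direction
  -- `-vec a z`, and the positive factor `t` does not change the argument. Unlike the sweep, this
  -- form is continuous at `t = 0`.
  let h : ℝ → ℝ := fun t => d.sweep (p t) w +
    (-vec (p t) (d.pos x) / vec (d.pos a) (d.pos z)).arg +
      (-vec (d.pos a) (d.pos z) / vec (p t) (d.pos y)).arg
  have hh : ∀ t ∈ Set.Ioc (0 : ℝ) 1, h t = 0 := by
    intro t ht
    have hva : vec (p t) (d.pos a) = -(t * vec (d.pos a) (d.pos z)) := by
      simp [vec, p]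
    have ht0 : (t : ℂ) ≠ 0 := by exact_mod_cast ht.1.ne'
    have hz0 : vec (d.pos a) (d.pos z) ≠ 0 :=
      fun h => hz.ne (d.injective (vec_eq_zero.1 h)).symm
    have e1 : turn (p t) (d.pos a) (d.pos x) =
        (-vec (p t) (d.pos x) / vec (d.pos a) (d.pos z)).arg := by
      rw [turn, hva, ← Complex.arg_real_mul (-vec (p t) (d.pos x) / vec (d.pos a) (d.pos z))
        (inv_pos.2 ht.1)]
      congr 1
      push_cast
      field_simp
    have e2 : turn (p t) (d.pos y) (d.pos a) =
        (-vec (d.pos a) (d.pos z) / vec (p t) (d.pos y)).arg := by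
      rw [turn, hva, ← Complex.arg_real_mul (-vec (d.pos a) (d.pos z) / vec (p t) (d.pos y)) ht.1]
      congr 1
      ring
    have := hC t ht
    simp only [C, sweep_cons, sweep_append, sweep_nil, e1, e2] at this
    simp only [h]
    linarith
  have hc : ContinuousAt h 0 := by
    have hy0 : vec (p 0) (d.pos y) ≠ 0 := by
      rw [hp0]; exact fun h => hy.ne (d.injective (vec_eq_zero.1 h)).symm
    have hz0 : vec (d.pos a) (d.pos z) ≠ 0 :=
      fun h => hz.ne (d.injective (vec_eq_zero.1 h)).symm
    refine ContinuousAt.add (ContinuousAt.add ?_ ?_) ?_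
    · refine ContinuousAt.comp (f := p) (g := fun q => d.sweep q w) ?_ hp.continuousAt
      rw [hp0]
      exact continuousAt_sweep w (offWalk_pos w hwa)
    · refine ContinuousAt.comp (g := Complex.arg)
        (f := fun t => -vec (p t) (d.pos x) / vec (d.pos a) (d.pos z)) ?_ ?_
      · rw [hp0]; exact Complex.continuousAt_arg (neg_div_mem_slitPlane hx hz hxz)
      · exact ((((continuous_vec_left _).comp hp).continuousAt).neg).div_const _
    · refine ContinuousAt.comp (g := Complex.arg)
        (f := fun t => -vec (d.pos a) (d.pos z) / vec (p t) (d.pos y)) ?_ ?_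
      · rw [hp0]; exact Complex.continuousAt_arg (neg_div_mem_slitPlane hz hy hyz.symm)
      · exact continuousAt_const.div ((continuous_vec_left _).comp hp).continuousAt hy0
  have h0 : h 0 = 0 := by
    have t1 : Tendsto h (𝓝[>] 0) (𝓝 (h 0)) := hc.tendsto.mono_left nhdsWithin_le_nhds
    have t2 : Tendsto h (𝓝[>] 0) (𝓝 0) := by
      refine tendsto_const_nhds.congr' ?_
      filter_upwards [Ioc_mem_nhdsGT (zero_lt_one' ℝ)] with t ht
      exact (hh t ht).symm
    exact tendsto_nhds_unique t1 t2
  simpa [h, hp0] using h0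

end PlaneDrawing

/-! ### Outerplanar graphs have no triads. -/

namespace SimpleGraph

variable {V : Type*}

/-- No vertex `a` has three neighbours any two of which are joined by a walk that avoids both `a`
and the third neighbour. -/
def NoTriad (G : SimpleGraph V) : Prop :=
  ∀ a x y z : V, G.Adj a x → G.Adj a y → G.Adj a z →
    (∃ w : G.Walk x y, a ∉ w.support ∧ z ∉ w.support) →
    (∃ w : G.Walk y z, a ∉ w.support ∧ x ∉ w.support) →
    (∃ w : G.Walk z x, a ∉ w.support ∧ y ∉ w.support) → False

/-- In the sum of the three identities of `sweep_add` the sweeps form that of a closed walk avoiding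
`a`, hence vanish, and each of three arguments occurs twice. So the three arguments sum to zero as
real numbers. Modulo `2π` the directions cancel and leave `3π`, a contradiction. -/
theorem IsOuterplanar.noTriad {G : SimpleGraph V} (hG : G.IsOuterplanar) : G.NoTriad := by
  obtain ⟨d, hd⟩ := hG
  rintro a x y z hx hy hz ⟨w₁, ha₁, hz₁⟩ ⟨w₂, ha₂, hx₂⟩ ⟨w₃, ha₃, hy₃⟩
  have h1 := hd.sweep_add hx hy hz w₁ ha₁ hz₁
  have h2 := hd.sweep_add hy hz hx w₂ ha₂ hx₂
  have h3 := hd.sweep_add hz hx hy w₃ ha₃ hy₃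
  have h0 := hd.sweep_eq_zero (a := a) ((w₁.append w₂).append w₃)
    (by simp [Walk.mem_support_append_iff, ha₁, ha₂, ha₃])
  simp only [PlaneDrawing.sweep_append] at h0
  have hne : ∀ {v : V}, G.Adj a v → PlaneDrawing.vec (d.pos a) (d.pos v) ≠ 0 :=
    fun h h' => h.ne (d.injective (PlaneDrawing.vec_eq_zero.1 h')).symm
  have hX := hne hx
  have hY := hne hy
  have hZ := hne hz
  generalize PlaneDrawing.vec (d.pos a) (d.pos x) = X at *
  generalize PlaneDrawing.vec (d.pos a) (d.pos y) = Y at *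
  generalize PlaneDrawing.vec (d.pos a) (d.pos z) = Z at *
  have hXZ := Complex.arg_div_coe_angle (neg_ne_zero.2 hX) hZ
  have hZY := Complex.arg_div_coe_angle (neg_ne_zero.2 hZ) hY
  have hYX := Complex.arg_div_coe_angle (neg_ne_zero.2 hY) hX
  rw [Complex.arg_neg_coe_angle hX] at hXZ
  rw [Complex.arg_neg_coe_angle hZ] at hZY
  rw [Complex.arg_neg_coe_angle hY] at hYX
  have hsum : (-X / Z).arg + (-Z / Y).arg + (-Y / X).arg = 0 := by linarith
  have hang := congrArg ((↑) : ℝ → Real.Angle) hsum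
  rw [Real.Angle.coe_add, Real.Angle.coe_add, hXZ, hZY, hYX, Real.Angle.coe_zero] at hang
  have hpi : (Real.pi : Real.Angle) + (Real.pi + Real.pi) = 0 := by
    rw [← hang]; abel
  rw [Real.Angle.coe_pi_add_coe_pi, add_zero] at hpi
  exact Real.Angle.pi_ne_zero hpi

/-! ### Crossing-free circular orders for graphs without triads. -/

variable {G : SimpleGraph V}

/-- No two edges of `G` cross when the vertices are placed in the order of the list on a line and
the edges are drawn on one side of it. -/
def NonCrossing (G : SimpleGraph V) (l : List V) : Prop :=
  ∀ a b c d : V, [a, b, c, d].Sublist l → G.Adj a c → ¬ G.Adj b d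

lemma exists_walk_of_isChain {l : List V} (hl : l.IsChain G.Adj) {x y : V} (hx : x ∈ l)
    (hy : y ∈ l) : ∃ w : G.Walk x y, ∀ z ∈ w.support, z ∈ l := by
  have key : ∀ (l : List V) (a : V), (a :: l).IsChain G.Adj → ∀ y ∈ a :: l,
      ∃ w : G.Walk a y, ∀ z ∈ w.support, z ∈ a :: l := by
    intro l
    induction l with
    | nil =>
      intro a _ y hy
      obtain rfl : y = a := by simpa using hy
      exact ⟨.nil, by simp⟩
    | cons b l ih =>
      intro a h y hy
      rw [List.isChain_cons_cons] at h
      rcases List.mem_cons.1 hy with rfl | hy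
      · exact ⟨.nil, by simp⟩
      · obtain ⟨w, hw⟩ := ih b h.2 y hy
        refine ⟨.cons h.1 w, fun z hz => ?_⟩
        rw [Walk.support_cons, List.mem_cons] at hz
        exact hz.elim (fun h => by simp [h]) fun h => List.mem_cons_of_mem _ (hw z h)
  cases l with
  | nil => simp at hx
  | cons a l =>
    obtain ⟨w₁, h₁⟩ := key l a hl x hx
    obtain ⟨w₂, h₂⟩ := key l a hl y hy
    refine ⟨w₁.reverse.append w₂, fun z hz => ?_⟩
    rw [Walk.mem_support_append_iff, Walk.support_reverse, List.mem_reverse] at hz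
    exact hz.elim (h₁ z) (h₂ z)

lemma exists_walk_avoiding {l : List V} (hl : l.IsChain G.Adj) {x y a z : V} (hx : x ∈ l)
    (hy : y ∈ l) (ha : a ∉ l) (hz : z ∉ l) :
    ∃ w : G.Walk x y, a ∉ w.support ∧ z ∉ w.support := by
  obtain ⟨w, hw⟩ := exists_walk_of_isChain hl hx hy
  exact ⟨w, fun h => ha (hw _ h), fun h => hz (hw _ h)⟩

lemma _root_.List.exists_eq_append_of_cons_sublist {α : Type*} {a : α} {l' l : List α}
    (h : (a :: l').Sublist l) : ∃ s t, l = s ++ a :: t ∧ l'.Sublist t := by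
  obtain ⟨r₁, r₂, rfl, ha, h'⟩ := List.cons_sublist_iff.1 h
  obtain ⟨s, t, rfl⟩ := List.append_of_mem ha
  exact ⟨s, t ++ r₂, by simp, h'.trans (List.sublist_append_right _ _)⟩

/-- In a graph without triads, no two chords of a cycle cross. -/
theorem NoTriad.nonCrossing_of_cycle (hG : G.NoTriad) {l : List V} (hn : l.Nodup)
    (hl : Cycle.Chain G.Adj (l : Cycle V)) : G.NonCrossing l := by
  intro a b c d hs hac hbd
  obtain ⟨s₀, t₀, rfl, hs₀⟩ := List.exists_eq_append_of_cons_sublist hs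
  obtain ⟨s₁, t₁, rfl, hs₁⟩ := List.exists_eq_append_of_cons_sublist hs₀
  obtain ⟨s₂, t₂, rfl, hs₂⟩ := List.exists_eq_append_of_cons_sublist hs₁
  obtain ⟨s₃, s₄, rfl, -⟩ := List.exists_eq_append_of_cons_sublist hs₂
  have hrot : (s₀ ++ a :: (s₁ ++ b :: (s₂ ++ c :: (s₃ ++ d :: s₄)))).IsRotated
      (a :: (s₁ ++ b :: (s₂ ++ c :: (s₃ ++ d :: (s₄ ++ s₀))))) := by
    have := List.isRotated_append (l := s₀) (l' := a :: (s₁ ++ b :: (s₂ ++ c :: (s₃ ++ d :: s₄))))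
    simpa using this
  rw [Cycle.coe_eq_coe.2 hrot, Cycle.chain_coe_cons] at hl
  rw [hrot.nodup_iff] at hn
  -- `p` and `q` are the neighbours of `a` on the cycle (possibly `b` and `d`). The triad is formed
  -- by `p`, `c`, `q`: `c` is joined to `p` and to `q` along the cycle, and `p` to `q` through the
  -- chord `bd`.
  obtain ⟨p, P, hP⟩ : ∃ p P, s₁ ++ [b] = p :: P := by cases s₁ <;> simp
  obtain ⟨Q, q, hQ⟩ : ∃ Q q, d :: (s₄ ++ s₀) = Q ++ [q] :=
    ⟨_, _, (List.dropLast_append_getLast (List.cons_ne_nil _ _)).symm⟩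
  have hpm : p ∈ s₁ ++ [b] := by simp [hP]
  have hqm : q ∈ d :: (s₄ ++ s₀) := by simp [hQ]
  have e1 : a :: (s₁ ++ b :: (s₂ ++ c :: (s₃ ++ d :: (s₄ ++ s₀))) ++ [a]) =
      [a] ++ p :: (P ++ (s₂ ++ c :: (s₃ ++ (Q ++ [q] ++ [a])))) := by
    rw [← hQ]
    have : p :: (P ++ (s₂ ++ c :: (s₃ ++ (d :: (s₄ ++ s₀) ++ [a])))) =
      s₁ ++ [b] ++ (s₂ ++ c :: (s₃ ++ (d :: (s₄ ++ s₀) ++ [a]))) := by rw [hP]; simp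
    rw [this]; simp
  have hap : G.Adj a p := by
    rw [e1] at hl
    exact (List.isChain_cons_cons.1 hl).1
  have hqa : G.Adj q a := by
    rw [e1] at hl
    have : [q, a] <:+: [a] ++ p :: (P ++ (s₂ ++ c :: (s₃ ++ (Q ++ [q] ++ [a])))) :=
      ⟨[a] ++ p :: (P ++ (s₂ ++ c :: (s₃ ++ Q))), [], by simp⟩
    simpa using hl.infix this
  have c1 : (s₁ ++ [b] ++ s₂ ++ [c]).IsChain G.Adj :=
    hl.infix ⟨[a], s₃ ++ d :: (s₄ ++ s₀) ++ [a], by simp⟩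
  have c2 : (c :: (s₃ ++ d :: (s₄ ++ s₀))).IsChain G.Adj :=
    hl.infix ⟨a :: (s₁ ++ b :: s₂), [a], by simp⟩
  have c3 : (s₁ ++ b :: d :: (s₄ ++ s₀)).IsChain G.Adj := by
    rw [List.isChain_split]
    refine ⟨hl.infix ⟨[a], s₂ ++ c :: (s₃ ++ d :: (s₄ ++ s₀)) ++ [a], by simp⟩, ?_⟩
    rw [List.isChain_cons_cons]
    exact ⟨hbd, hl.infix ⟨a :: (s₁ ++ b :: (s₂ ++ c :: s₃)), [a], by simp⟩⟩
  have hn' : (a :: ((s₁ ++ [b]) ++ (s₂ ++ c :: (s₃ ++ (d :: (s₄ ++ s₀)))))).Nodup := by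
    simpa using hn
  have hac' : a ∉ s₁ ++ [b] ∧ a ∉ s₂ ∧ a ≠ c ∧ a ∉ s₃ ∧ a ∉ d :: (s₄ ++ s₀) := by
    have := (List.nodup_cons.1 hn').1
    simp only [List.mem_append, List.mem_cons, not_or] at this ⊢
    tauto
  generalize hL : s₁ ++ [b] = L at *
  generalize hM : d :: (s₄ ++ s₀) = M at *
  have hLM : s₁ ++ b :: M = L ++ M := by simp [← hL]
  rw [hLM] at c3
  have hn2 := (List.nodup_cons.1 hn').2
  simp only [List.nodup_append, List.nodup_cons, List.mem_append, List.mem_cons] at hn2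
  refine hG a p c q hap hac hqa.symm ?_ ?_ ?_
  · exact exists_walk_avoiding c1 (by simp [hpm]) (by simp) (by simp; tauto) (by simp; grind)
  · exact exists_walk_avoiding c2 (by simp) (by simp [hqm]) (by simp; tauto) (by simp; grind)
  · exact exists_walk_avoiding c3 (by simp [hqm]) (by simp [hpm]) (by simp; tauto) (by simp; grind)

/-- Rotating a list preserves the absence of crossings. -/
lemma NonCrossing.append_comm {l₁ l₂ : List V} (h : G.NonCrossing (l₁ ++ l₂)) :
    G.NonCrossing (l₂ ++ l₁) := by
  intro a b c d hs hac hbd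
  obtain ⟨u, w, he, hu, hw⟩ := List.sublist_append_iff.1 hs
  have hs' := hw.append hu
  have hu4 : u.length + w.length = 4 := by
    have := congrArg List.length he; simpa using this.symm
  rcases u with _ | ⟨x, _ | ⟨y, _ | ⟨z, _ | ⟨t, _ | ⟨_, _⟩⟩⟩⟩⟩ <;> simp at he
  · subst he; exact h _ _ _ _ (by simpa using hs') hac hbd
  · obtain ⟨rfl, rfl⟩ := he; exact h _ _ _ _ (by simpa using hs') hbd hac.symm
  · obtain ⟨rfl, rfl, rfl⟩ := he; exact h _ _ _ _ (by simpa using hs') hac.symm hbd.symm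
  · obtain ⟨rfl, rfl, rfl, rfl⟩ := he; exact h _ _ _ _ (by simpa using hs') hbd.symm hac
  · obtain ⟨rfl, rfl, rfl, rfl, rfl⟩ := he; exact h _ _ _ _ (by simpa using hs') hac hbd

/-- Gluing two crossing-free orders at a common vertex that separates the two parts. -/
lemma NonCrossing.glue {a : V} {l₁ l₂ : List V} (h₁ : G.NonCrossing (a :: l₁))
    (h₂ : G.NonCrossing (a :: l₂)) (hn₁ : (a :: l₁).Nodup)
    (h : ∀ x ∈ l₁, ∀ y ∈ l₂, ¬ G.Adj x y) : G.NonCrossing (a :: l₁ ++ l₂) := by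
  intro p q r s hs hpr hqs
  obtain ⟨u, w, he, hu, hw⟩ := List.sublist_append_iff.1 hs
  have hun := hn₁.sublist hu
  have hmem : ∀ x ∈ u, x = a ∨ x ∈ l₁ := fun x hx => List.mem_cons.1 (hu.subset hx)
  have htail : ∀ x u', u = x :: u' → ∀ y ∈ u', y ∈ l₁ := by
    rintro x u' rfl y hy
    have := hu.tail
    exact this.subset hy
  rcases u with _ | ⟨x, _ | ⟨y, _ | ⟨z, _ | ⟨t, _ | ⟨_, _⟩⟩⟩⟩⟩ <;> simp at he
  · subst he; exact h₂ _ _ _ _ (hw.trans (List.sublist_cons_self _ _)) hpr hqs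
  · obtain ⟨rfl, rfl⟩ := he
    rcases hmem p (by simp) with rfl | hp
    · exact h₂ _ _ _ _ (hw.cons_cons _) hpr hqs
    · exact h p hp r (hw.subset (by simp)) hpr
  · obtain ⟨rfl, rfl, rfl⟩ := he
    exact h q (htail _ _ rfl q (by simp)) s (hw.subset (by simp)) hqs
  · obtain ⟨rfl, rfl, rfl, rfl⟩ := he
    exact h q (htail _ _ rfl q (by simp)) s (hw.subset (by simp)) hqs
  · obtain ⟨rfl, rfl, rfl, rfl, rfl⟩ := he; exact h₁ _ _ _ _ hu hpr hqs

/-- The lists of at least two vertices of `S` that form a closed simple cycle of `G` (an edge being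
a cycle with two vertices). -/
def IsCycleIn (G : SimpleGraph V) (S : Finset V) (l : List V) : Prop :=
  l.Nodup ∧ (∀ z ∈ l, z ∈ S) ∧ Cycle.Chain G.Adj (l : Cycle V) ∧ 2 ≤ l.length

/-- The part `S` of the graph cannot be disconnected by the removal of a vertex. -/
def Unseparated (G : SimpleGraph V) [DecidableEq V] (S : Finset V) : Prop :=
  ∀ a ∈ S, ∀ A ⊆ S.erase a, A.Nonempty → (S.erase a \ A).Nonempty →
    ∃ x ∈ A, ∃ y ∈ S.erase a \ A, G.Adj x y

/-- A path in `S` with interior off the cycle `x :: t`, from `x` to another vertex of the cycle. -/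
lemma Unseparated.exists_ear [DecidableEq V] {S : Finset V} (hS : G.Unseparated S) {l : List V}
    (hl : G.IsCycleIn S l) {s : V} (hs : s ∈ S) (hsl : s ∉ l) :
    ∃ x y t₁ t₂ p, l.IsRotated (x :: (t₁ ++ y :: t₂)) ∧ p ≠ [] ∧
      (x :: (p ++ [y])).IsChain G.Adj ∧ p.Nodup ∧ ∀ z ∈ p, z ∈ S ∧ z ∉ l := by
  obtain ⟨hn, hlS, -, h2⟩ := hl
  -- After the removal of one cycle vertex, some edge still joins the rest of the cycle to the
  -- outside.
  obtain ⟨x, hxl, v, hvS, hvl, hxv⟩ : ∃ x ∈ l, ∃ v ∈ S, v ∉ l ∧ G.Adj x v := by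
    match l, h2 with
    | a :: b :: l, _ =>
      have hab : b ≠ a := by rintro rfl; simp at hn
      obtain ⟨x, hx, y, hy, hxy⟩ := hS a (hlS a (by simp)) ((a :: b :: l).toFinset.erase a)
        (Finset.erase_subset_erase _ fun z hz => hlS z (List.mem_toFinset.1 hz))
        ⟨b, by simp [hab]⟩ ⟨s, by simp at hsl ⊢; tauto⟩
      refine ⟨x, List.mem_toFinset.1 (Finset.mem_of_mem_erase hx), y, ?_, ?_, hxy⟩
      · simp at hy; tauto
      · simp at hy ⊢; tauto
  obtain ⟨l₁, l₂, rfl⟩ := List.append_of_mem hxl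
  have hrot : (l₁ ++ x :: l₂).IsRotated (x :: (l₂ ++ l₁)) := by
    simpa using List.isRotated_append (l := l₁) (l' := x :: l₂)
  have hmem : ∀ z, z ∈ l₁ ++ x :: l₂ ↔ z ∈ x :: (l₂ ++ l₁) := fun z => hrot.mem_iff
  rw [hrot.nodup_iff] at hn
  have h2' : 2 ≤ (x :: (l₂ ++ l₁)).length := hrot.perm.length_eq ▸ h2
  simp only [hmem] at *
  generalize l₂ ++ l₁ = t at *
  obtain ⟨b, hb⟩ : ∃ b, b ∈ t := by
    cases t with
    | nil => simp at h2'
    | cons b t => exact ⟨b, by simp⟩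
  let H := G.induce {z | z ∈ S ∧ z ∉ x :: t}
  let v' : {z | z ∈ S ∧ z ∉ x :: t} := ⟨v, hvS, hvl⟩
  classical
  -- The vertices reachable from `v` off the cycle. When `x` is removed some edge leaves `R`; by
  -- maximality of `R` it ends on the cycle.
  let R : Finset V := S.filter fun r => ∃ h : r ∈ S ∧ r ∉ x :: t, H.Reachable v' ⟨r, h⟩
  have hxt := (List.nodup_cons.1 hn).1
  obtain ⟨r, hr, y, hy, hry⟩ := hS x (hlS x (by simp)) R
    (fun r hr => by
      obtain ⟨hrS, hr, -⟩ := Finset.mem_filter.1 hr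
      exact Finset.mem_erase.2 ⟨fun h => hr.2 (by simp [h]), hrS⟩)
    ⟨v, Finset.mem_filter.2 ⟨hvS, ⟨hvS, hvl⟩, Reachable.refl _⟩⟩
    ⟨b, Finset.mem_sdiff.2 ⟨Finset.mem_erase.2 ⟨fun h => hxt (h ▸ hb), hlS b (by simp [hb])⟩,
      fun h => by
        obtain ⟨_, h, -⟩ := Finset.mem_filter.1 h
        exact h.2 (by simp [hb])⟩⟩
  obtain ⟨_, hr', hreach⟩ := Finset.mem_filter.1 hr
  obtain ⟨hy1, hy2⟩ := Finset.mem_sdiff.1 hy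
  obtain ⟨hyx, hyS⟩ := Finset.mem_erase.1 hy1
  have hyt : y ∈ t := by
    by_contra hyt
    have hy' : y ∈ S ∧ y ∉ x :: t := ⟨hyS, by simp [hyx, hyt]⟩
    have hadj : H.Adj ⟨r, hr'⟩ ⟨y, hy'⟩ := hry
    exact hy2 (Finset.mem_filter.2 ⟨hyS, hy', hreach.trans hadj.reachable⟩)
  obtain ⟨w, hw⟩ := hreach.exists_isPath
  obtain ⟨t₁, t₂, rfl⟩ := List.append_of_mem hyt
  let f : H →g G := ⟨Subtype.val, fun h => h⟩
  have hsupp : w.support.map Subtype.val = (w.map f).support := (w.support_map f).symm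
  refine ⟨x, y, t₁, t₂, w.support.map Subtype.val, hrot,
    fun h => w.support_ne_nil (List.map_eq_nil_iff.1 h), ?_, ?_, ?_⟩
  · have := (Walk.cons hxv ((w.map f).append (Walk.cons hry Walk.nil))).isChain_adj_support
    rw [hsupp]
    simpa [Walk.support_append] using this
  · exact hw.support_nodup.map Subtype.val_injective
  · intro z hz
    obtain ⟨z, -, rfl⟩ := List.mem_map.1 hz
    exact z.2

/-- A cycle that misses a vertex of an unseparated part of a graph without triads is not a longest
cycle in this part. -/
lemma NoTriad.exists_longer_cycle (hG : G.NoTriad) [DecidableEq V] {S : Finset V}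
    (hS : G.Unseparated S) {l : List V} (hl : G.IsCycleIn S l) {s : V} (hs : s ∈ S)
    (hsl : s ∉ l) : ∃ l', G.IsCycleIn S l' ∧ l.length < l'.length := by
  obtain ⟨x, y, t₁, t₂, p, hrot, hp, hpc, hpn, hpS⟩ := hS.exists_ear hl hs hsl
  obtain ⟨hn, hlS, hc, -⟩ := hl
  rw [Cycle.coe_eq_coe.2 hrot, Cycle.chain_coe_cons] at hc
  rw [hrot.nodup_iff] at hn
  rw [hrot.perm.length_eq]
  simp only [fun z => hrot.mem_iff (a := z)] at hlS hpS
  have hpl : 1 ≤ p.length := List.length_pos_of_ne_nil hp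
  have hc' : (x :: t₁ ++ y :: (t₂ ++ [x])).IsChain G.Adj := by simpa using hc
  rw [List.isChain_split] at hc'
  have hpr : (y :: (p.reverse ++ [x])).IsChain G.Adj := by
    have : (x :: (p ++ [y])).reverse.IsChain G.Adj :=
      List.isChain_reverse.2 (hpc.imp fun _ _ h => h.symm)
    simpa using this
  simp only [List.nodup_cons, List.nodup_append, List.mem_append, List.mem_cons] at hn hpS
  -- If one of the two arcs between `x` and `y` has no inner vertex, the ear replaces it and the
  -- cycle grows.
  rcases eq_or_ne t₁ [] with rfl | h₁
  · refine ⟨x :: (p ++ y :: t₂), ⟨?_, ?_, ?_, by simp; omega⟩, by simp; omega⟩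
    · simp only [List.nodup_cons, List.nodup_append, List.mem_append, List.mem_cons]
      grind
    · simp only [List.mem_append, List.mem_cons]
      grind
    · rw [Cycle.chain_coe_cons]
      have : ((x :: p) ++ y :: (t₂ ++ [x])).IsChain G.Adj :=
        List.isChain_split.2 ⟨by simpa using hpc, hc'.2⟩
      simpa using this
  rcases eq_or_ne t₂ [] with rfl | h₂
  · refine ⟨x :: (t₁ ++ y :: p.reverse), ⟨?_, ?_, ?_, by simp; omega⟩, by simp; omega⟩
    · simp only [List.nodup_cons, List.nodup_append, List.mem_append, List.mem_cons,
        List.nodup_reverse, List.mem_reverse]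
      grind
    · simp only [List.mem_append, List.mem_cons, List.mem_reverse]
      grind
    · rw [Cycle.chain_coe_cons]
      have : ((x :: t₁) ++ y :: (p.reverse ++ [x])).IsChain G.Adj :=
        List.isChain_split.2 ⟨hc'.1, hpr⟩
      simpa using this
  -- Otherwise the two arcs and the ear are three paths from `x` to `y` with inner vertices. Their
  -- first or last inner vertices next to `x` form a triad at `x`, since any two of the paths
  -- connect through `y`.
  exfalso
  obtain ⟨b, t₁', rfl⟩ := List.exists_cons_of_ne_nil h₁
  obtain ⟨t₂', e, rfl⟩ : ∃ t e, t₂ = t ++ [e] :=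
    ⟨_, _, (List.dropLast_append_getLast h₂).symm⟩
  obtain ⟨v, p', rfl⟩ := List.exists_cons_of_ne_nil hp
  have hxb : G.Adj x b := (List.isChain_cons_cons.1 hc'.1).1
  have hxv : G.Adj x v := (List.isChain_cons_cons.1 hpc).1
  have hex : G.Adj e x := by
    simpa using hc'.2.infix (l₁ := [e, x]) ⟨y :: t₂', [], by simp⟩
  have c1 : ((b :: t₁') ++ y :: (v :: p').reverse).IsChain G.Adj := by
    refine List.isChain_split.2 ⟨hc'.1.infix ⟨[x], [], by simp⟩, hpr.infix ⟨[], [x], by simp⟩⟩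
  have c2 : ((v :: p') ++ y :: (t₂' ++ [e])).IsChain G.Adj := by
    refine List.isChain_split.2 ⟨hpc.infix ⟨[x], [], by simp⟩, hc'.2.infix ⟨[], [x], by simp⟩⟩
  have c3 : ((b :: t₁') ++ y :: (t₂' ++ [e])).IsChain G.Adj :=
    hc.infix ⟨[x], [x], by simp⟩
  simp only [List.nodup_cons, List.nodup_append, List.mem_append, List.mem_cons] at hn hpS
  refine hG x b v e hxb hxv hex.symm ?_ ?_ ?_
  · exact exists_walk_avoiding c1 (by simp) (by simp) (by simp; grind) (by simp; grind)
  · exact exists_walk_avoiding c2 (by simp) (by simp) (by simp; grind) (by simp; grind)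
  · exact exists_walk_avoiding c3 (by simp) (by simp) (by simp; grind) (by simp; grind)

lemma NoTriad.exists_hamiltonian (hG : G.NoTriad) [DecidableEq V] {S : Finset V}
    (hS : G.Unseparated S) (h4 : 4 ≤ S.card) : ∃ l, G.IsCycleIn S l ∧ ∀ z ∈ S, z ∈ l := by
  by_contra hcon
  push Not at hcon
  have key : ∀ k, ∃ l, G.IsCycleIn S l ∧ k ≤ l.length := by
    intro k
    induction k with
    | zero =>
      obtain ⟨a, ha, b, hb, c, hc, hab, hac, hbc⟩ := Finset.two_lt_card.1 (by omega : 2 < S.card)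
      -- Any edge serves as the initial cycle with two vertices.
      obtain ⟨x, hx, y, hy, hxy⟩ := hS a ha {b} (by simp [hab.symm, hb]) (by simp)
        ⟨c, by simp [hac.symm, hbc.symm, hc]⟩
      obtain rfl := Finset.mem_singleton.1 hx
      simp only [Finset.mem_sdiff, Finset.mem_erase] at hy
      refine ⟨[x, y], ⟨by simp [hxy.ne], by simp [hb, hy.1.2], ?_, by simp⟩, by simp⟩
      rw [Cycle.chain_coe_cons]
      simp [hxy, hxy.symm]
    | succ k ih =>
      obtain ⟨l, hl, hk⟩ := ih
      obtain ⟨s, hs, hsl⟩ := hcon l hl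
      obtain ⟨l', hl', h⟩ := hG.exists_longer_cycle hS hl hs hsl
      exact ⟨l', hl', by omega⟩
  obtain ⟨l, hl, hk⟩ := key (S.card + 1)
  have : l.length ≤ S.card := by
    rw [← List.toFinset_card_of_nodup hl.1]
    exact Finset.card_le_card fun z hz => hl.2.1 z (List.mem_toFinset.1 hz)
  omega

/-- The vertices of a finite graph without triads can be placed on a circle such that no two edges
cross. -/
theorem NoTriad.exists_nonCrossing (hG : G.NoTriad) (S : Finset V) :
    ∃ l : List V, l.Nodup ∧ (∀ z, z ∈ l ↔ z ∈ S) ∧ G.NonCrossing l := by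
  classical
  induction S using Finset.strongInduction with
  | H S ih =>
  rcases le_or_gt S.card 3 with h3 | h4
  · refine ⟨S.toList, S.nodup_toList, by simp, fun a b c d hs => ?_⟩
    have := hs.length_le
    simp at this
    omega
  by_cases hS : G.Unseparated S
  · obtain ⟨l, hl, hlS⟩ := hG.exists_hamiltonian hS h4
    exact ⟨l, hl.1, fun z => ⟨hl.2.1 z, hlS z⟩, hG.nonCrossing_of_cycle hl.1 hl.2.2.1⟩
  unfold Unseparated at hS
  push Not at hS
  obtain ⟨a, ha, A, hA, ⟨x, hx⟩, ⟨y, hy⟩, hAB⟩ := hS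
  have haA : a ∉ A := fun h => (Finset.mem_erase.1 (hA h)).1 rfl
  -- Both sides of the cut vertex `a` are ordered by induction and rotated to begin with `a`, ready
  -- for gluing.
  have key : ∀ T ⊂ S, a ∈ T → ∃ l : List V, (a :: l).Nodup ∧ (∀ z, z ∈ a :: l ↔ z ∈ T) ∧
      G.NonCrossing (a :: l) := by
    intro T hT haT
    obtain ⟨l, hn, hl, hc⟩ := ih T hT
    obtain ⟨l₁, l₂, rfl⟩ := List.append_of_mem ((hl a).2 haT)
    have hrot : (l₁ ++ a :: l₂).IsRotated (a :: (l₂ ++ l₁)) := by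
      simpa using List.isRotated_append (l := l₁) (l' := a :: l₂)
    exact ⟨l₂ ++ l₁, hrot.nodup_iff.1 hn, fun z => by rw [← hrot.mem_iff, hl],
      by simpa using hc.append_comm⟩
  simp only [Finset.mem_sdiff, Finset.mem_erase] at hy hAB
  obtain ⟨l₁, hn₁, hl₁, hc₁⟩ := key (insert a A)
    (Finset.ssubset_iff_subset_ne.2 ⟨Finset.insert_subset ha (hA.trans (S.erase_subset a)),
      fun h => by
        have : y ∈ insert a A := h ▸ hy.1.2
        simp [hy.1.1, hy.2] at this⟩) (by simp)
  obtain ⟨l₂, hn₂, hl₂, hc₂⟩ := key (S \ A)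
    (Finset.sdiff_ssubset (hA.trans (S.erase_subset a)) ⟨x, hx⟩) (by simp [ha, haA])
  simp only [List.mem_cons, Finset.mem_insert, Finset.mem_sdiff] at hl₁ hl₂
  rw [List.nodup_cons] at hn₁ hn₂
  refine ⟨a :: l₁ ++ l₂, ?_, ?_, hc₁.glue hc₂ (List.nodup_cons.2 hn₁) ?_⟩
  · simp only [List.cons_append, List.nodup_cons, List.nodup_append, List.mem_append]
    grind
  · intro z
    have hA' : ∀ z ∈ A, z ∈ S := fun z hz => Finset.mem_of_mem_erase (hA hz)
    simp only [List.cons_append, List.mem_append, List.mem_cons]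
    grind
  · intro u hu w hw
    exact hAB u (by grind) w (by grind)

end SimpleGraph

/-! ### Outerplane drawings on a parabola. -/

/-- The point of the standard parabola over `t`. -/
noncomputable def parabola (t : ℝ) : EuclideanSpace ℝ (Fin 2) := !₂[t, t ^ 2]

@[simp] lemma parabola_zero (t : ℝ) : parabola t 0 = t := by simp [parabola]

@[simp] lemma parabola_one (t : ℝ) : parabola t 1 = t ^ 2 := by simp [parabola]

lemma eq_of_mem_segment_parabola {s t : ℝ} {p : EuclideanSpace ℝ (Fin 2)}
    (hp : p ∈ segment ℝ (parabola s) (parabola t)) :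
    p 1 = (s + t) * p 0 - s * t ∧ ∃ r ∈ Set.Icc (0 : ℝ) 1, p 0 = (1 - r) * s + r * t := by
  obtain ⟨q, r, hq, hr, hqr, rfl⟩ := hp
  obtain rfl : q = 1 - r := by linarith
  refine ⟨by simp; ring, r, ⟨hr, by linarith⟩, by simp⟩

lemma mem_Ioo_of_mem_openSegment_parabola {s t : ℝ} (hst : s < t) {p : EuclideanSpace ℝ (Fin 2)}
    (hp : p ∈ openSegment ℝ (parabola s) (parabola t)) : p 0 ∈ Set.Ioo s t := by
  obtain ⟨q, r, hq, hr, hqr, rfl⟩ := hp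
  obtain rfl : q = 1 - r := by linarith
  constructor <;> simp <;> nlinarith

lemma notMem_segment_parabola {s t r : ℝ} (hs : r ≠ s) (ht : r ≠ t) :
    parabola r ∉ segment ℝ (parabola s) (parabola t) := by
  intro h
  obtain ⟨h1, -⟩ := eq_of_mem_segment_parabola h
  simp only [parabola_zero, parabola_one] at h1
  have : (r - s) * (r - t) = 0 := by linarith
  rcases mul_eq_zero.1 this with h | h
  · exact hs (sub_eq_zero.1 h)
  · exact ht (sub_eq_zero.1 h)

/-- Two different chords of the parabola that do not cross are disjoint. -/
lemma disjoint_openSegment_parabola {s t s' t' : ℝ} (hst : s < t) (hst' : s' < t')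
    (hne : ¬ (s = s' ∧ t = t')) (h₁ : ¬ (s < s' ∧ s' < t ∧ t < t'))
    (h₂ : ¬ (s' < s ∧ s < t' ∧ t' < t)) :
    Disjoint (openSegment ℝ (parabola s) (parabola t))
      (openSegment ℝ (parabola s') (parabola t')) := by
  rw [Set.disjoint_left]
  intro p hp hp'
  obtain ⟨e, -⟩ := eq_of_mem_segment_parabola (openSegment_subset_segment ℝ _ _ hp)
  obtain ⟨e', -⟩ := eq_of_mem_segment_parabola (openSegment_subset_segment ℝ _ _ hp')
  obtain ⟨a, b⟩ := mem_Ioo_of_mem_openSegment_parabola hst hp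
  obtain ⟨a', b'⟩ := mem_Ioo_of_mem_openSegment_parabola hst' hp'
  -- Both sides are the height of `p` above the parabola. For nested chords the outer one is
  -- strictly higher.
  have key : (p 0 - s) * (t - p 0) = (p 0 - s') * (t' - p 0) := by linarith
  rcases lt_trichotomy s s' with h | rfl | h
  · have : t' ≤ t := by
      by_contra hc
      exact h₁ ⟨h, by linarith, by linarith⟩
    nlinarith
  · have : t = t' := by
      have := mul_left_cancel₀ (by linarith : p 0 - s ≠ 0) key
      linarith
    exact hne ⟨rfl, this⟩
  · have : t ≤ t' := by
      by_contra hc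
      exact h₂ ⟨h, by linarith, by linarith⟩
    nlinarith

namespace SimpleGraph

variable {V : Type*} {G : SimpleGraph V}

/-- When the vertices are placed on a line according to the injective map `f` and the edges are
drawn on one side of it, no two edges cross. -/
def IsNonCrossing (G : SimpleGraph V) (f : V → ℕ) : Prop :=
  Function.Injective f ∧
    ∀ a b c d : V, f a < f b → f b < f c → f c < f d → G.Adj a c → ¬ G.Adj b d

lemma NonCrossing.isNonCrossing [DecidableEq V] {l : List V} (hl : G.NonCrossing l)
    (hmem : ∀ v, v ∈ l) : G.IsNonCrossing fun v => l.idxOf v := by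
  refine ⟨fun a b h => List.idxOf_inj (hmem a) |>.1 h, fun a b c d hab hbc hcd => hl a b c d ?_⟩
  dsimp only at hab hbc hcd
  have hlt : ∀ v, l.idxOf v < l.length := fun v => List.idxOf_lt_length_iff.2 (hmem v)
  have := List.map_getElem_sublist (l := l)
    (is := [⟨_, hlt a⟩, ⟨_, hlt b⟩, ⟨_, hlt c⟩, ⟨_, hlt d⟩]) (by simp; omega)
  simpa using this

/-- The straight-line drawing of a graph with the vertices on a parabola. -/
noncomputable def IsNonCrossing.drawing {f : V → ℕ} (h : G.IsNonCrossing f) : PlaneDrawing G where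
  pos v := parabola (f v)
  injective u v huv := by
    have := congrArg (fun p : EuclideanSpace ℝ (Fin 2) => p 0) huv
    simp only [parabola_zero, Nat.cast_inj] at this
    exact h.1 this
  vertex_notMem u v w _ hu hv :=
    notMem_segment_parabola (by simpa using h.1.ne hu) (by simpa using h.1.ne hv)
  crossing_free := by
    have key : ∀ u v w x : V, G.Adj u v → G.Adj w x → s(u, v) ≠ s(w, x) → f u < f v → f w < f x →
        Disjoint (openSegment ℝ (parabola (f u)) (parabola (f v)))
          (openSegment ℝ (parabola (f w)) (parabola (f x))) := by
      intro u v w x huv hwx hne h1 h2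
      refine disjoint_openSegment_parabola (by exact_mod_cast h1) (by exact_mod_cast h2) ?_ ?_ ?_
      · rintro ⟨e1, e2⟩
        rw [h.1 (Nat.cast_injective e1), h.1 (Nat.cast_injective e2)] at hne
        exact hne rfl
      · rintro ⟨a, b, c⟩
        exact h.2 u w v x (by exact_mod_cast a) (by exact_mod_cast b) (by exact_mod_cast c) huv hwx
      · rintro ⟨a, b, c⟩
        exact h.2 w u x v (by exact_mod_cast a) (by exact_mod_cast b) (by exact_mod_cast c) hwx huv
    intro u v w x huv hwx hne
    rcases (h.1.ne huv.ne).lt_or_gt with h1 | h1 <;> rcases (h.1.ne hwx.ne).lt_or_gt with h2 | h2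
    · exact key u v w x huv hwx hne h1 h2
    · rw [openSegment_symm ℝ (parabola (f w))]
      exact key u v x w huv hwx.symm (by rwa [Sym2.eq_swap (a := x)]) h1 h2
    · rw [openSegment_symm ℝ (parabola (f u))]
      exact key v u w x huv.symm hwx (by rwa [Sym2.eq_swap (a := v)]) h1 h2
    · rw [openSegment_symm ℝ (parabola (f u)), openSegment_symm ℝ (parabola (f w))]
      exact key v u x w huv.symm hwx.symm
        (by rwa [Sym2.eq_swap (a := v), Sym2.eq_swap (a := x)]) h1 h2

lemma IsNonCrossing.drawing_pos {f : V → ℕ} (h : G.IsNonCrossing f) (v : V) :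
    h.drawing.pos v = parabola (f v) := rfl

/-- The points below the parabola. -/
def belowParabola : Set (EuclideanSpace ℝ (Fin 2)) := {p | p 1 < p 0 ^ 2}

lemma isPreconnected_belowParabola : IsPreconnected belowParabola := by
  have : belowParabola = (fun x : ℝ × ℝ => (!₂[x.1, x.1 ^ 2 - x.2] : EuclideanSpace ℝ (Fin 2))) ''
      (Set.univ ×ˢ Set.Ioi 0) := by
    ext p
    simp only [belowParabola, Set.mem_ofPred_eq, Set.mem_image, Set.mem_prod, Set.mem_univ,
      true_and, Set.mem_Ioi, Prod.exists]
    constructor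
    · intro hp
      refine ⟨p 0, p 0 ^ 2 - p 1, by linarith, ?_⟩
      ext i
      fin_cases i <;> simp
    · rintro ⟨a, b, hb, rfl⟩
      simpa using hb
  rw [this]
  refine (isPreconnected_univ.prod isPreconnected_Ioi).image _ ?_
  fun_prop

lemma not_isBounded_belowParabola : ¬ Bornology.IsBounded belowParabola := by
  intro h
  obtain ⟨R, hR⟩ := (Metric.isBounded_iff_subset_closedBall 0).1 h
  have hmem : (!₂[0, -(|R| + 1)] : EuclideanSpace ℝ (Fin 2)) ∈ belowParabola := by
    have := abs_nonneg R
    simp [belowParabola]; linarith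
  have := hR hmem
  rw [mem_closedBall_zero_iff] at this
  have h1 := (PiLp.norm_apply_le (!₂[0, -(|R| + 1)] : EuclideanSpace ℝ (Fin 2)) 1).trans this
  simp only [Matrix.cons_val_one, Matrix.cons_val_fin_one, norm_neg,
    Real.norm_eq_abs] at h1
  rw [abs_of_pos (by positivity)] at h1
  linarith [le_abs_self R]

lemma IsNonCrossing.sq_le_of_mem_support {f : V → ℕ} (h : G.IsNonCrossing f)
    {p : EuclideanSpace ℝ (Fin 2)} (hp : p ∈ h.drawing.support) : p 0 ^ 2 ≤ p 1 := by
  rcases hp with ⟨v, rfl⟩ | ⟨u, v, -, hp⟩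
  · simp [drawing_pos]
  · obtain ⟨e, r, ⟨h0, h1⟩, hr⟩ := eq_of_mem_segment_parabola hp
    rw [e]
    have h1' : 0 ≤ 1 - r := by linarith
    have h2 : 0 ≤ r * (1 - r) * ((f u : ℝ) - f v) ^ 2 := by positivity
    have h3 : (f u + f v) * p 0 - f u * f v - p 0 ^ 2 = r * (1 - r) * ((f u : ℝ) - f v) ^ 2 := by
      rw [hr]; ring
    linarith

/-- The region below the parabola is connected, unbounded and free of the drawing, so it belongs to
the outer face. Every vertex is a limit of its points. -/
theorem IsNonCrossing.isOuterplane {f : V → ℕ} (h : G.IsNonCrossing f) :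
    h.drawing.IsOuterplane := by
  have hsub : belowParabola ⊆ h.drawing.supportᶜ := fun p hp hs => by
    have h1 := h.sq_le_of_mem_support hs
    have h2 : p 1 < p 0 ^ 2 := hp
    linarith
  have hface : belowParabola ⊆ h.drawing.outerFace := fun p hp =>
    ⟨hsub hp, fun hb => not_isBounded_belowParabola (hb.subset
      (isPreconnected_belowParabola.subset_connectedComponentIn hp hsub))⟩
  intro v
  refine ⟨closure_mono hface ?_, fun hi => (interior_subset hi).1 (Or.inl ⟨v, rfl⟩)⟩
  rw [drawing_pos]
  have hc : Continuous fun s : ℝ => (!₂[(f v : ℝ), (f v : ℝ) ^ 2 - s] : EuclideanSpace ℝ (Fin 2)) := by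
    fun_prop
  have h0 : parabola (f v) = (fun s : ℝ => (!₂[(f v : ℝ), (f v : ℝ) ^ 2 - s] :
      EuclideanSpace ℝ (Fin 2))) 0 := by simp [parabola]
  rw [h0]
  refine mem_closure_of_tendsto (b := nhdsWithin (0 : ℝ) (Set.Ioi 0))
    (hc.tendsto 0 |>.mono_left nhdsWithin_le_nhds) ?_
  filter_upwards [self_mem_nhdsWithin] with s hs
  simpa [belowParabola] using hs

theorem IsNonCrossing.isOuterplanar {f : V → ℕ} (h : G.IsNonCrossing f) : G.IsOuterplanar :=
  ⟨_, h.isOuterplane⟩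

/-- The affine function that vanishes on the line through the points of the parabola over `s` and `t`. -/
def chordForm (s t : ℝ) (p : EuclideanSpace ℝ (Fin 2)) : ℝ := p 1 - (s + t) * p 0 + s * t

lemma chordForm_parabola (s t r : ℝ) : chordForm s t (parabola r) = (r - s) * (r - t) := by
  simp [chordForm]; ring

lemma convex_chordForm (s t : ℝ) (σ : ℝ) : Convex ℝ {p | 0 ≤ σ * chordForm s t p} := by
  intro p hp q hq a b ha hb hab
  simp only [Set.mem_ofPred_eq] at *
  have : σ * chordForm s t (a • p + b • q) =
      a * (σ * chordForm s t p) + b * (σ * chordForm s t q) := by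
    obtain rfl : a = 1 - b := by linarith
    simp [chordForm]; ring
  rw [this]
  positivity

/-- A small move by `-r • (0, σ)` stays in the half-plane and lowers the value by `r * σ ^ 2`, so
the value was positive. -/
lemma interior_chordForm {s t σ : ℝ} (hσ : σ ≠ 0) {p : EuclideanSpace ℝ (Fin 2)}
    (hp : p ∈ interior {p | 0 ≤ σ * chordForm s t p}) : 0 < σ * chordForm s t p := by
  have hc : Continuous fun r : ℝ => p - r • (!₂[0, σ] : EuclideanSpace ℝ (Fin 2)) := by fun_prop
  have h0 : ∀ᶠ r in nhdsWithin (0 : ℝ) (Set.Ioi 0),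
      p - r • (!₂[0, σ] : EuclideanSpace ℝ (Fin 2)) ∈ {p | 0 ≤ σ * chordForm s t p} := by
    refine nhdsWithin_le_nhds ((hc.tendsto 0).eventually ?_)
    rw [zero_smul, sub_zero]
    exact mem_interior_iff_mem_nhds.1 hp
  obtain ⟨r, h1, h2⟩ := (h0.and self_mem_nhdsWithin).exists
  have h3 : σ * chordForm s t (p - r • (!₂[0, σ] : EuclideanSpace ℝ (Fin 2))) =
      σ * chordForm s t p - r * σ ^ 2 := by
    simp [chordForm]; ring
  rw [Set.mem_ofPred_eq, h3] at h1
  have : 0 < r * σ ^ 2 := mul_pos h2 (by positivity)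
  linarith

/-- In the drawing on a parabola any three pairwise adjacent vertices bound a face. -/
theorem IsNonCrossing.isTriangle {f : V → ℕ} (h : G.IsNonCrossing f) {a b c : V} (hab : f a < f b)
    (hbc : f b < f c) (h₁ : G.Adj a b) (h₂ : G.Adj b c) (h₃ : G.Adj a c) :
    h.drawing.IsTriangle a b c := by
  refine ⟨h₁, h₂, h₃, ?_⟩
  have hab' : (f a : ℝ) < f b := by exact_mod_cast hab
  have hbc' : (f b : ℝ) < f c := by exact_mod_cast hbc
  have hint : ∀ s t σ : ℝ, σ ≠ 0 → (∀ v ∈ ({a, b, c} : Set V),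
      0 ≤ σ * chordForm s t (parabola (f v))) →
      ∀ p ∈ interior (convexHull ℝ {h.drawing.pos a, h.drawing.pos b, h.drawing.pos c}),
        0 < σ * chordForm s t p := by
    intro s t σ hσ hv p hp
    refine interior_chordForm hσ (interior_mono (convexHull_min ?_ (convex_chordForm s t σ)) hp)
    rintro q (rfl | rfl | rfl)
    · exact hv a (by simp)
    · exact hv b (by simp)
    · exact hv c (by simp)
  rw [Set.disjoint_left]
  intro p hp hs
  -- The triangle lies above the chords `ab` and `bc` and below the chord `ac`; `σ` records the
  -- side.
  have i1 := hint (f a) (f b) 1 one_ne_zero (by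
    rintro v (rfl | rfl | rfl) <;> rw [chordForm_parabola] <;> nlinarith) p hp
  have i2 := hint (f b) (f c) 1 one_ne_zero (by
    rintro v (rfl | rfl | rfl) <;> rw [chordForm_parabola] <;> nlinarith) p hp
  have i3 := hint (f a) (f c) (-1) (by norm_num) (by
    rintro v (rfl | rfl | rfl) <;> rw [chordForm_parabola] <;> nlinarith) p hp
  have seg : ∀ s t σ : ℝ, ∀ u v : V, p ∈ segment ℝ (parabola (f u)) (parabola (f v)) →
      0 ≤ σ * chordForm s t (parabola (f u)) → 0 ≤ σ * chordForm s t (parabola (f v)) →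
      0 ≤ σ * chordForm s t p := fun s t σ u v hp hu hv =>
    (convex_chordForm s t σ).segment_subset hu hv hp
  have main : ∀ u v : V, f u ≤ f v → (u = v ∨ G.Adj u v) →
      p ∉ segment ℝ (parabola (f u)) (parabola (f v)) := by
    intro u v huv hadj hp
    have huv' : (f u : ℝ) ≤ f v := by exact_mod_cast huv
    -- An edge that crosses no side has both ends over `[a, b]`, both over `[b, c]`, or both outside
    -- the open interval from `a` to `c`. In each case one side of the triangle separates it from
    -- `p`.
    have hcase : (f a ≤ f u ∧ f v ≤ f b) ∨ (f b ≤ f u ∧ f v ≤ f c) ∨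
        ((f u ≤ f a ∨ f c ≤ f u) ∧ (f v ≤ f a ∨ f c ≤ f v)) := by
      rcases hadj with rfl | hadj
      · omega
      · by_contra hcon
        have n1 := h.2 a u b v
        have n2 := h.2 b u c v
        have n3 := h.2 u a v b
        have n4 := h.2 u b v c
        have n5 := h.2 a u c v
        have n6 := h.2 u a v c
        simp only [h₁, h₂, h₃, hadj, not_true_eq_false, imp_false, not_lt] at *
        omega
    rcases hcase with ⟨x, y⟩ | ⟨x, y⟩ | ⟨x, y⟩
    · have x' : (f a : ℝ) ≤ f u := by exact_mod_cast x
      have y' : (f v : ℝ) ≤ f b := by exact_mod_cast y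
      have := seg (f a) (f b) (-1) u v hp (by rw [chordForm_parabola]; nlinarith)
        (by rw [chordForm_parabola]; nlinarith)
      linarith
    · have x' : (f b : ℝ) ≤ f u := by exact_mod_cast x
      have y' : (f v : ℝ) ≤ f c := by exact_mod_cast y
      have := seg (f b) (f c) (-1) u v hp (by rw [chordForm_parabola]; nlinarith)
        (by rw [chordForm_parabola]; nlinarith)
      linarith
    · have out : ∀ w, (f w ≤ f a ∨ f c ≤ f w) →
          0 ≤ 1 * chordForm (f a) (f c) (parabola (f w)) := by
        rintro w (hw | hw)
        · have : (f w : ℝ) ≤ f a := by exact_mod_cast hw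
          rw [chordForm_parabola]; nlinarith
        · have : (f c : ℝ) ≤ f w := by exact_mod_cast hw
          rw [chordForm_parabola]; nlinarith
      have := seg (f a) (f c) 1 u v hp (out u x) (out v y)
      linarith
  rcases hs with ⟨v, rfl⟩ | ⟨u, v, hadj, hp⟩
  · exact main v v le_rfl (Or.inl rfl) (by simp [drawing_pos])
  · rcases le_total (f u) (f v) with huv | huv
    · exact main u v huv (Or.inr hadj) hp
    · exact main v u huv (Or.inr hadj.symm) (segment_symm ℝ (parabola (f u)) _ ▸ hp)

/-! ### Triangulated polygons, frames and ears. -/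

/-- A crossing-free graph, with the vertices on a line according to `f`, to which no edge can be
added without a crossing: a triangulated polygon. -/
def IsTriangulation (G : SimpleGraph V) (f : V → ℕ) : Prop :=
  G.IsNonCrossing f ∧ ∀ u v, f u < f v → ¬ G.Adj u v →
    ∃ x y, G.Adj x y ∧ f u < f x ∧ f x < f v ∧ (f y < f u ∨ f v < f y)

/-- The apex is the last neighbour `k` of `i` before `j`. If `kj` were missing, the edge crossing it
would cross `ij` or `ik`, or end at `i` and give a later neighbour. -/
lemma IsTriangulation.exists_apex [Fintype V] {f : V → ℕ} (h : G.IsTriangulation f) {i j w : V}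
    (hij : G.Adj i j) (hiw : f i < f w) (hwj : f w < f j) :
    ∃ k, f i < f k ∧ f k < f j ∧ G.Adj i k ∧ G.Adj k j := by
  classical
  -- The successor of `i` is adjacent to `i`, as no vertex lies between them from which an edge
  -- could cross. So the maximum below is over a nonempty set.
  obtain ⟨m, hm, hmin⟩ := Finset.exists_min_image (Finset.univ.filter fun v => f i < f v) f
    ⟨w, by simp [hiw]⟩
  simp only [Finset.mem_filter, Finset.mem_univ, true_and] at hm hmin
  have him : G.Adj i m := by
    by_contra hn
    obtain ⟨x, y, -, h1, h2, -⟩ := h.2 i m hm hn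
    have := hmin x h1
    omega
  have hmj : f m < f j := (hmin w hiw).trans_lt hwj
  obtain ⟨k, hk, hmax⟩ := Finset.exists_max_image
    (Finset.univ.filter fun v => f i < f v ∧ f v < f j ∧ G.Adj i v) f
    ⟨m, by simp [hm, hmj, him]⟩
  simp only [Finset.mem_filter, Finset.mem_univ, true_and] at hk hmax
  refine ⟨k, hk.1, hk.2.1, hk.2.2, ?_⟩
  by_contra hn
  obtain ⟨x, y, hxy, h1, h2, h3⟩ := h.2 k j hk.2.1 hn
  rcases h3 with h3 | h3
  · rcases lt_trichotomy (f y) (f i) with h4 | h4 | h4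
    · exact h.1.2 y i x j h4 (hk.1.trans h1) h2 hxy.symm hij
    · obtain rfl := h.1.1 h4
      have := hmax x ⟨hk.1.trans h1, h2, hxy.symm⟩
      omega
    · exact h.1.2 i y k x h4 h3 h1 hk.2.2 hxy.symm
  · exact h.1.2 i x j y (hk.1.trans h1) h2 h3 hij hxy

/-- The vertices `i` and `j` of `S` are neighbours in the order of the vertices of `S`. -/
def Consecutive (f : V → ℕ) (S : Finset V) (i j : V) : Prop :=
  i ∈ S ∧ j ∈ S ∧ f i < f j ∧ ∀ w ∈ S, ¬ (f i < f w ∧ f w < f j)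

/-- `S` contains the first and the last vertex, and consecutive vertices of `S` are adjacent. -/
def IsFrame (G : SimpleGraph V) (f : V → ℕ) (S : Finset V) : Prop :=
  (∀ v, ∃ u ∈ S, f u ≤ f v) ∧ (∀ v, ∃ u ∈ S, f v ≤ f u) ∧
    ∀ i j, Consecutive f S i j → G.Adj i j

/-- The vertex `k` is the apex of a triangle over two consecutive vertices of `S`. -/
structure IsEar (G : SimpleGraph V) (f : V → ℕ) (S : Finset V) (i j k : V) : Prop where
  consecutive : Consecutive f S i j
  left_lt : f i < f k
  lt_right : f k < f j
  adj : G.Adj i j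
  adj_left : G.Adj i k
  adj_right : G.Adj k j

lemma IsEar.notMem {f : V → ℕ} {S : Finset V} {i j k : V} (h : G.IsEar f S i j k) : k ∉ S :=
  fun hk => h.consecutive.2.2.2 k hk ⟨h.left_lt, h.lt_right⟩

/-- The edge `ij` separates `k` from the other vertices of `S`. -/
lemma IsEar.eq_or_eq_of_adj {f : V → ℕ} {S : Finset V} {i j k w : V} (h : G.IsEar f S i j k)
    (hf : G.IsNonCrossing f) (hw : w ∈ S) (hkw : G.Adj k w) : w = i ∨ w = j := by
  by_contra! hcon
  have h1 := hf.1.ne hcon.1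
  have h2 := hf.1.ne hcon.2
  have h3 := h.consecutive.2.2.2 w hw
  have h4 := hf.2 w i k j
  have h5 := hf.2 i k j w
  simp only [h.adj, hkw, hkw.symm, h.left_lt, h.lt_right, not_true_eq_false, imp_false,
    forall_const] at h4 h5
  omega

lemma IsEar.consecutive_insert [DecidableEq V] {f : V → ℕ} {S : Finset V} {i j k p q : V}
    (h : G.IsEar f S i j k) (hf : Function.Injective f) (hc : Consecutive f (insert k S) p q) :
    (p = i ∧ q = k) ∨ (p = k ∧ q = j) ∨ Consecutive f S p q := by
  obtain ⟨hp, hq, hpq, hw⟩ := hc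
  obtain ⟨hi, hj, hij, hS⟩ := h.consecutive
  have h1 := h.left_lt
  have h2 := h.lt_right
  have hwS : ∀ w ∈ S, ¬ (f p < f w ∧ f w < f q) := fun w hw' => hw w (by simp [hw'])
  rcases Finset.mem_insert.1 hp with rfl | hp'
  · rcases Finset.mem_insert.1 hq with rfl | hq'
    · omega
    · have := hwS j hj
      have := hS q hq'
      exact Or.inr (Or.inl ⟨rfl, hf (by omega)⟩)
  · rcases Finset.mem_insert.1 hq with rfl | hq'
    · have := hwS i hi
      have := hS p hp'
      exact Or.inl ⟨hf (by omega), rfl⟩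
    · exact Or.inr (Or.inr ⟨hp', hq', hpq, hwS⟩)

lemma IsEar.isFrame_insert [DecidableEq V] {f : V → ℕ} {S : Finset V} {i j k : V}
    (h : G.IsEar f S i j k) (hf : Function.Injective f) (hS : G.IsFrame f S) :
    G.IsFrame f (insert k S) := by
  refine ⟨fun v => ?_, fun v => ?_, fun p q hpq => ?_⟩
  · obtain ⟨u, hu, h⟩ := hS.1 v
    exact ⟨u, by simp [hu], h⟩
  · obtain ⟨u, hu, h⟩ := hS.2.1 v
    exact ⟨u, by simp [hu], h⟩
  · rcases h.consecutive_insert hf hpq with ⟨rfl, rfl⟩ | ⟨rfl, rfl⟩ | hc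
    · exact h.adj_left
    · exact h.adj_right
    · exact hS.2.2 p q hc

/-- The vertex `w` falls between two consecutive vertices of `S`. These are adjacent, so their edge
has an apex. -/
lemma IsTriangulation.exists_ear [Fintype V] {f : V → ℕ} (h : G.IsTriangulation f) {S : Finset V}
    (hS : G.IsFrame f S) {w : V} (hw : w ∉ S) : ∃ i j k, G.IsEar f S i j k := by
  classical
  have hne : ∀ v ∈ S, f v ≠ f w := fun v hv => h.1.1.ne (fun h => hw (h ▸ hv))
  obtain ⟨a, ha, haw⟩ := hS.1 w
  obtain ⟨b, hb, hbw⟩ := hS.2.1 w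
  obtain ⟨i, hi, hmax⟩ := Finset.exists_max_image (S.filter fun v => f v < f w) f
    ⟨a, by simp [ha, haw.lt_of_ne (hne a ha)]⟩
  obtain ⟨j, hj, hmin⟩ := Finset.exists_min_image (S.filter fun v => f w < f v) f
    ⟨b, by simp [hb, hbw.lt_of_ne (hne b hb).symm]⟩
  simp only [Finset.mem_filter] at hi hj hmax hmin
  have hc : Consecutive f S i j := by
    refine ⟨hi.1, hj.1, hi.2.trans hj.2, fun v hv hvw => ?_⟩
    rcases (hne v hv).lt_or_gt with h1 | h1
    · have := hmax v ⟨hv, h1⟩; omega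
    · have := hmin v ⟨hv, h1⟩; omega
  have hij := hS.2.2 i j hc
  obtain ⟨k, h1, h2, h3, h4⟩ := h.exists_apex hij hi.2 hj.2
  exact ⟨i, j, k, hc, h1, h2, hij, h3, h4⟩

/-! ### Extending a five-colouring over an ear. -/

section Colouring

variable [DecidableEq V]

open Classical in
/-- The colours in the closed neighbourhood of `v` within `S`. -/
noncomputable def seen (G : SimpleGraph V) (S : Finset V) (c : V → Fin 5) (v : V) :
    Finset (Fin 5) :=
  (S.filter fun w => w = v ∨ G.Adj v w).image c

lemma mem_seen {S : Finset V} {c : V → Fin 5} {v : V} {e : Fin 5} :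
    e ∈ G.seen S c v ↔ ∃ w ∈ S, (w = v ∨ G.Adj v w) ∧ c w = e := by
  simp [seen, and_assoc]

lemma card_le_card_seen {S : Finset V} {c : V → Fin 5} (hc : Set.InjOn c S) {T : Finset V}
    (hT : T ⊆ S) {v : V} (h : ∀ w ∈ T, w = v ∨ G.Adj v w) : T.card ≤ (G.seen S c v).card := by
  rw [← Finset.card_image_of_injOn (hc.mono hT)]
  refine Finset.card_le_card fun e he => ?_
  obtain ⟨w, hw, rfl⟩ := Finset.mem_image.1 he
  exact mem_seen.2 ⟨w, hT hw, h w hw, rfl⟩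

lemma card_le_card_seen_union {S : Finset V} {c : V → Fin 5} (hc : Set.InjOn c S) {T : Finset V}
    (hT : T ⊆ S) {u v : V} (h : ∀ w ∈ T, (w = u ∨ G.Adj u w) ∨ (w = v ∨ G.Adj v w)) :
    T.card ≤ (G.seen S c u ∪ G.seen S c v).card := by
  rw [← Finset.card_image_of_injOn (hc.mono hT)]
  refine Finset.card_le_card fun e he => ?_
  obtain ⟨w, hw, rfl⟩ := Finset.mem_image.1 he
  exact Finset.mem_union.2 ((h w hw).imp (fun h => mem_seen.2 ⟨w, hT hw, h, rfl⟩)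
    (fun h => mem_seen.2 ⟨w, hT hw, h, rfl⟩))

/-- Each triangle within `S` sees all five colours, and each pair of consecutive vertices sees
enough colours for the colouring to be extended. -/
structure IsGoodColouring (G : SimpleGraph V) (f : V → ℕ) (S : Finset V) (c : V → Fin 5) :
    Prop where
  ne : ∀ i j, Consecutive f S i j → c i ≠ c j
  three_le_left : ∀ i j, Consecutive f S i j → 3 ≤ (G.seen S c i).card
  three_le_right : ∀ i j, Consecutive f S i j → 3 ≤ (G.seen S c j).card
  four_le : ∀ i j, Consecutive f S i j → 4 ≤ (G.seen S c i ∪ G.seen S c j).card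
  eq_univ : ∀ x ∈ S, ∀ y ∈ S, ∀ z ∈ S, G.Adj x y → G.Adj y z → G.Adj x z →
    G.seen S c x ∪ G.seen S c y ∪ G.seen S c z = Finset.univ

/-- `A` and `B` are the colours seen by the ends of a boundary edge and `e` is the colour of the new
apex. If `A ∪ B` misses a colour, that one works. Otherwise the two common colours give `A.card +
B.card ≥ 7`, so at most one of the sets has only three colours, and a colour missing from that set
is taken; if neither has, any colour other than `a` and `b` works. -/
lemma exists_colour {A B : Finset (Fin 5)} {a b : Fin 5} (hab : a ≠ b) (haA : a ∈ A) (hbA : b ∈ A)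
    (haB : a ∈ B) (hbB : b ∈ B) (hA : 3 ≤ A.card) (hB : 3 ≤ B.card) (hAB : 4 ≤ (A ∪ B).card) :
    ∃ e, e ≠ a ∧ e ≠ b ∧ 4 ≤ (insert e A).card ∧ 4 ≤ (insert e B).card ∧
      insert e (A ∪ B) = Finset.univ := by
  have hle : (A ∪ B).card ≤ 5 := Finset.card_le_univ _
  have hinter : 2 ≤ (A ∩ B).card := by
    rw [← Finset.card_pair hab]
    exact Finset.card_le_card (by intro x; simp; rintro (rfl | rfl) <;> simp [*])
  have hsum := Finset.card_union_add_card_inter A B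
  have huniv : ∀ T : Finset (Fin 5), T.card = 5 → T = Finset.univ := fun T hT =>
    Finset.eq_univ_of_card T (by simpa using hT)
  have hmiss : ∀ T : Finset (Fin 5), T.card ≤ 4 → ∃ e, e ∉ T := fun T hT => by
    by_contra! h
    have : T = Finset.univ := Finset.eq_univ_iff_forall.2 h
    rw [this] at hT
    simp at hT
  have hins : ∀ (T : Finset (Fin 5)) e, T.card ≤ (insert e T).card := fun T e =>
    Finset.card_le_card (Finset.subset_insert e T)
  rcases (by omega : (A ∪ B).card = 4 ∨ (A ∪ B).card = 5) with h | h
  · obtain ⟨e, he⟩ := hmiss _ h.le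
    have heA : e ∉ A := fun h => he (Finset.mem_union_left _ h)
    have heB : e ∉ B := fun h => he (Finset.mem_union_right _ h)
    refine ⟨e, fun h => heA (h ▸ haA), fun h => heA (h ▸ hbA), ?_, ?_, huniv _ ?_⟩
    · rw [Finset.card_insert_of_notMem heA]; omega
    · rw [Finset.card_insert_of_notMem heB]; omega
    · rw [Finset.card_insert_of_notMem he]; omega
  have hfull : ∀ e, insert e (A ∪ B) = Finset.univ := fun e => by
    rw [huniv _ h]; simp
  rcases (by omega : A.card = 3 ∨ 4 ≤ A.card) with h3 | h3
  · obtain ⟨e, he⟩ := hmiss A (by omega)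
    refine ⟨e, fun h => he (h ▸ haA), fun h => he (h ▸ hbA), ?_, ?_, hfull e⟩
    · rw [Finset.card_insert_of_notMem he]; omega
    · have := hins B e; omega
  rcases (by omega : B.card = 3 ∨ 4 ≤ B.card) with h4 | h4
  · obtain ⟨e, he⟩ := hmiss B (by omega)
    refine ⟨e, fun h => he (h ▸ haB), fun h => he (h ▸ hbB), ?_, ?_, hfull e⟩
    · have := hins A e; omega
    · rw [Finset.card_insert_of_notMem he]; omega
  · obtain ⟨e, he⟩ := hmiss {a, b} (by rw [Finset.card_pair hab]; omega)
    simp only [Finset.mem_insert, Finset.mem_singleton, not_or] at he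
    exact ⟨e, he.1, he.2, h3.trans (hins A e), h4.trans (hins B e), hfull e⟩

/-- Sets of seen colours only grow. On the new boundary edges `ik` and `kj` the old ends now see
four colours and `k` sees the three distinct colours of the ear. The only new triangle is `ijk`,
because `k` has no other neighbour in `S`, and `i` and `j` together see all colours. -/
lemma IsGoodColouring.exists_insert {f : V → ℕ} {S : Finset V} {c : V → Fin 5}
    (hc : G.IsGoodColouring f S c) (hf : G.IsNonCrossing f) {i j k : V}
    (h : G.IsEar f S i j k) : ∃ c', G.IsGoodColouring f (insert k S) c' := by
  have hi := h.consecutive.1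
  have hj := h.consecutive.2.1
  have hk := h.notMem
  obtain ⟨e, hea, heb, hA, hB, hu⟩ := exists_colour (hc.ne i j h.consecutive)
    (mem_seen.2 ⟨i, hi, Or.inl rfl, rfl⟩) (mem_seen.2 ⟨j, hj, Or.inr h.adj, rfl⟩)
    (mem_seen.2 ⟨i, hi, Or.inr h.adj.symm, rfl⟩) (mem_seen.2 ⟨j, hj, Or.inl rfl, rfl⟩)
    (hc.three_le_left i j h.consecutive) (hc.three_le_right i j h.consecutive)
    (hc.four_le i j h.consecutive)
  have hupd : ∀ w ∈ S, Function.update c k e w = c w := fun w hw =>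
    Function.update_of_ne (ne_of_mem_of_not_mem hw hk) _ _
  have hmono : ∀ v, G.seen S c v ⊆ G.seen (insert k S) (Function.update c k e) v := by
    intro v x hx
    obtain ⟨w, hw, hvw, rfl⟩ := mem_seen.1 hx
    exact mem_seen.2 ⟨w, Finset.mem_insert_of_mem hw, hvw, hupd w hw⟩
  have hek : ∀ v, v = k ∨ G.Adj v k → e ∈ G.seen (insert k S) (Function.update c k e) v :=
    fun v hv => mem_seen.2 ⟨k, by simp, hv.imp_left Eq.symm, by simp⟩
  have hsi : insert e (G.seen S c i) ⊆ G.seen (insert k S) (Function.update c k e) i :=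
    Finset.insert_subset (hek i (Or.inr h.adj_left)) (hmono i)
  have hsj : insert e (G.seen S c j) ⊆ G.seen (insert k S) (Function.update c k e) j :=
    Finset.insert_subset (hek j (Or.inr h.adj_right.symm)) (hmono j)
  have hsk : 3 ≤ (G.seen (insert k S) (Function.update c k e) k).card := by
    have hsub : {e, c i, c j} ⊆ G.seen (insert k S) (Function.update c k e) k := by
      intro x hx
      simp only [Finset.mem_insert, Finset.mem_singleton] at hx
      rcases hx with rfl | rfl | rfl
      · exact hek k (Or.inl rfl)
      · exact mem_seen.2 ⟨i, by simp [hi], Or.inr h.adj_left.symm, hupd i hi⟩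
      · exact mem_seen.2 ⟨j, by simp [hj], Or.inr h.adj_right, hupd j hj⟩
    have := Finset.card_le_card hsub
    rwa [Finset.card_eq_three.2 ⟨e, c i, c j, hea, heb, hc.ne i j h.consecutive, rfl⟩] at this
  have hi4 := hA.trans (Finset.card_le_card hsi)
  have hj4 := hB.trans (Finset.card_le_card hsj)
  have huniv : G.seen (insert k S) (Function.update c k e) i ∪
      G.seen (insert k S) (Function.update c k e) j = Finset.univ := by
    rw [← Finset.univ_subset_iff, ← hu]
    intro x hx
    rw [← Finset.insert_union] at hx
    rcases Finset.mem_union.1 hx with hx | hx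
    · exact Finset.mem_union_left _ (hsi hx)
    · exact Finset.mem_union_right _ (hmono j hx)
  have hS : ∀ v ∈ insert k S, v = k ∨ v ∈ S := fun v hv => Finset.mem_insert.1 hv
  have hnb : ∀ v ∈ insert k S, G.Adj k v → v = i ∨ v = j := fun v hv hkv =>
    (hS v hv).elim (fun h' => (hkv.ne h'.symm).elim) fun hv => h.eq_or_eq_of_adj hf hv hkv
  have htri : ∀ x ∈ insert k S, ∀ y ∈ insert k S, G.Adj k x → G.Adj x y → G.Adj k y →
      G.seen (insert k S) (Function.update c k e) x ∪
        G.seen (insert k S) (Function.update c k e) y = Finset.univ := by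
    intro x hx y hy hkx hxy hky
    rcases hnb x hx hkx with rfl | rfl <;> rcases hnb y hy hky with rfl | rfl
    · exact (hxy.ne rfl).elim
    · exact huniv
    · rw [Finset.union_comm]; exact huniv
    · exact (hxy.ne rfl).elim
  have hsup : ∀ {A B : Finset (Fin 5)}, A ⊆ B → A = Finset.univ → B = Finset.univ :=
    fun hAB hA => Finset.univ_subset_iff.1 (hA ▸ hAB)
  refine ⟨Function.update c k e, fun p q hpq => ?_, fun p q hpq => ?_, fun p q hpq => ?_,
    fun p q hpq => ?_, fun x hx y hy z hz hxy hyz hxz => ?_⟩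
  · rcases h.consecutive_insert hf.1 hpq with ⟨rfl, rfl⟩ | ⟨rfl, rfl⟩ | hcon
    · rw [hupd p hi]; simpa using hea.symm
    · rw [hupd q hj]; simpa using heb
    · rw [hupd p hcon.1, hupd q hcon.2.1]; exact hc.ne p q hcon
  · rcases h.consecutive_insert hf.1 hpq with ⟨rfl, rfl⟩ | ⟨rfl, rfl⟩ | hcon
    · omega
    · exact hsk
    · exact (hc.three_le_left p q hcon).trans (Finset.card_le_card (hmono p))
  · rcases h.consecutive_insert hf.1 hpq with ⟨rfl, rfl⟩ | ⟨rfl, rfl⟩ | hcon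
    · exact hsk
    · omega
    · exact (hc.three_le_right p q hcon).trans (Finset.card_le_card (hmono q))
  · rcases h.consecutive_insert hf.1 hpq with ⟨rfl, rfl⟩ | ⟨rfl, rfl⟩ | hcon
    · exact hi4.trans (Finset.card_le_card Finset.subset_union_left)
    · exact hj4.trans (Finset.card_le_card Finset.subset_union_right)
    · exact (hc.four_le p q hcon).trans
        (Finset.card_le_card (Finset.union_subset_union (hmono p) (hmono q)))
  · rcases hS x hx with rfl | hxS
    · exact hsup (by grind) (htri y hy z hz hxy hyz hxz)
    rcases hS y hy with rfl | hyS
    · exact hsup (by grind) (htri x hx z hz hxy.symm hxz hyz)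
    rcases hS z hz with rfl | hzS
    · exact hsup (by grind) (htri x hx y hy hxz.symm hxy hyz.symm)
    · exact hsup (Finset.union_subset_union (Finset.union_subset_union (hmono x) (hmono y))
        (hmono z)) (hc.eq_univ x hxS y hyS z hzS hxy hyz hxz)

end Colouring

/-! ### The initial pentagon and the colouring of the whole polygon. -/

/-- The vertex `v` lies in a triangle of `G`. -/
def InTriangle (G : SimpleGraph V) (v : V) : Prop :=
  ∃ y z, G.Adj v y ∧ G.Adj y z ∧ G.Adj v z

lemma IsTriangulation.exists_isFrame_pair [Fintype V] [DecidableEq V] {f : V → ℕ}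
    (h : G.IsTriangulation f) (hV : 2 ≤ Fintype.card V) :
    ∃ a b, f a < f b ∧ G.IsFrame f {a, b} := by
  have : Nontrivial V := Fintype.one_lt_card_iff_nontrivial.1 hV
  obtain ⟨a, -, ha⟩ := Finset.exists_min_image Finset.univ f Finset.univ_nonempty
  obtain ⟨b, -, hb⟩ := Finset.exists_max_image Finset.univ f Finset.univ_nonempty
  simp only [Finset.mem_univ, forall_const] at ha hb
  obtain ⟨u, v, huv⟩ := exists_pair_ne V
  have := h.1.1.ne huv
  have hab : f a < f b := by
    have := ha u; have := ha v; have := hb u; have := hb v; omega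
  have hadj : G.Adj a b := by
    by_contra hn
    obtain ⟨x, y, -, -, -, h1⟩ := h.2 a b hab hn
    have := ha y; have := hb y; omega
  refine ⟨a, b, hab, fun v => ⟨a, by simp, ha v⟩, fun v => ⟨b, by simp, hb v⟩, fun i j hc => ?_⟩
  obtain ⟨hi, hj, hij, -⟩ := hc
  simp only [Finset.mem_insert, Finset.mem_singleton] at hi hj
  rcases hi with rfl | rfl <;> rcases hj with rfl | rfl <;> first | exact hadj | omega

/-- A frame with four vertices consists of two triangles `abs` and `abt`. -/
lemma IsTriangulation.exists_isFrame_four [Fintype V] [DecidableEq V] {f : V → ℕ}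
    (h : G.IsTriangulation f) (hV : 4 ≤ Fintype.card V) :
    ∃ a b s t, G.IsFrame f {a, b, s, t} ∧ [a, b, s, t].Nodup ∧ G.Adj a b ∧ G.Adj a s ∧ G.Adj b s ∧
      G.Adj a t ∧ G.Adj b t ∧ ¬ G.Adj s t := by
  have hmiss : ∀ S : Finset V, S.card < 4 → ∃ w, w ∉ S := fun S hS => by
    by_contra! hcon
    rw [Finset.eq_univ_iff_forall.2 hcon, Finset.card_univ] at hS
    omega
  obtain ⟨lo, hi, hlt, h2⟩ := h.exists_isFrame_pair (by omega)
  obtain ⟨w, hw⟩ := hmiss {lo, hi} (Finset.card_le_two.trans_lt (by norm_num))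
  obtain ⟨i, j, k, he⟩ := h.exists_ear h2 hw
  obtain ⟨rfl, rfl⟩ : i = lo ∧ j = hi := by
    have h1 := he.consecutive.1
    have h2 := he.consecutive.2.1
    have h3 := he.consecutive.2.2.1
    simp only [Finset.mem_insert, Finset.mem_singleton] at h1 h2
    rcases h1 with rfl | rfl <;> rcases h2 with rfl | rfl <;> first | exact ⟨rfl, rfl⟩ | omega
  have h3 := he.isFrame_insert h.1.1 h2
  obtain ⟨w', hw'⟩ := hmiss {k, i, j} (Finset.card_le_three.trans_lt (by norm_num))
  obtain ⟨p, q, l, he'⟩ := h.exists_ear h3 hw'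
  have h4 := he'.isFrame_insert h.1.1 h3
  have hl := he'.notMem
  have hlt1 := he.left_lt
  have hlt2 := he.lt_right
  have hlt3 := he'.left_lt
  have hlt4 := he'.lt_right
  have hnb : ∀ w ∈ ({k, i, j} : Finset V), G.Adj l w → w = p ∨ w = q := fun w hw hlw =>
    he'.eq_or_eq_of_adj h.1 hw hlw
  -- The second ear cannot stand on `ij`, which `k` has split, so it stands on a side of the first
  -- triangle. That side becomes the common edge of the two triangles.
  have hpq : (p = i ∧ q = k) ∨ (p = k ∧ q = j) := by
    rcases he.consecutive_insert h.1.1 he'.consecutive with h | h | h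
    · exact Or.inl h
    · exact Or.inr h
    · exfalso
      have h1 := h.1
      have h2 := h.2.1
      have h3 := h.2.2.1
      simp only [Finset.mem_insert, Finset.mem_singleton] at h1 h2
      have := he'.consecutive.2.2.2 k (by simp)
      rcases h1 with rfl | rfl <;> rcases h2 with rfl | rfl <;> omega
  simp only [Finset.mem_insert, Finset.mem_singleton, not_or] at hl
  have hki : k ≠ i := fun h => by rw [h] at hlt1; omega
  have hkj : k ≠ j := fun h => by rw [h] at hlt2; omega
  have hij : i ≠ j := fun h => by rw [h] at hlt; omega
  rcases hpq with ⟨rfl, rfl⟩ | ⟨rfl, rfl⟩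
  · refine ⟨p, q, j, l, ?_, ?_, he.adj_left, he.adj, he.adj_right, he'.adj_left,
      he'.adj_right.symm, fun hadj => ?_⟩
    · convert h4 using 1
      ext; simp; tauto
    · simp; grind
    · rcases hnb j (by simp) hadj.symm with h | h <;> grind
  · refine ⟨p, q, i, l, ?_, ?_, he.adj_right, he.adj_left.symm, he.adj.symm, he'.adj_left,
      he'.adj_right.symm, fun hadj => ?_⟩
    · convert h4 using 1
      ext; simp; tauto
    · simp; grind
    · rcases hnb i (by simp) hadj.symm with h | h <;> grind

/-- The pentagons obtained from the two triangles `abs` and `abt` by adding an ear at `a`. -/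
lemma isGoodColouring_of_pentagon [DecidableEq V] {f : V → ℕ} {S : Finset V} {a b s t k m : V}
    (hn : [a, b, s, t, k].Nodup) (hmemS : ∀ w, w ∈ S ↔ w = a ∨ w = b ∨ w = s ∨ w = t ∨ w = k)
    (hfr : G.IsFrame f S) (hab : G.Adj a b)
    (has : G.Adj a s) (hbs : G.Adj b s) (hat : G.Adj a t) (hbt : G.Adj b t) (hst : ¬ G.Adj s t)
    (hak : G.Adj a k) (hkm : G.Adj k m) (hm : m = b ∨ m = s ∨ m = t)
    (hk : ∀ w ∈ S, G.Adj k w → w = a ∨ w = m) : ∃ c, G.IsGoodColouring f S c := by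
  have hcard : S.card = 5 := by
    have hS : S = [a, b, s, t, k].toFinset := by ext w; simp [hmemS]
    rw [hS, List.toFinset_card_of_nodup hn]; rfl
  simp only [List.nodup_cons, List.mem_cons, List.not_mem_nil, or_false, not_or] at hn
  -- The five vertices get five different colours, so counting seen colours means counting vertices.
  -- The vertex `a` is adjacent to all others and sees everything.
  let g : S ≃ Fin 5 := S.equivFinOfCardEq hcard
  let c : V → Fin 5 := fun v => if hv : v ∈ S then g ⟨v, hv⟩ else 0
  have hc : Set.InjOn c S := by
    intro u hu v hv huv
    have hu' : u ∈ S := hu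
    have hv' : v ∈ S := hv
    simp only [c, hu', hv', dif_pos] at huv
    simpa using g.injective huv
  have haU : ∀ w ∈ S, w = a ∨ G.Adj a w := by
    intro w hw
    rcases (hmemS w).1 hw with rfl | rfl | rfl | rfl | rfl <;> simp [*]
  have hsa : G.seen S c a = Finset.univ := by
    refine Finset.eq_univ_of_card _ (le_antisymm (Finset.card_le_univ _) ?_)
    rw [Fintype.card_fin]
    exact hcard.symm.le.trans (card_le_card_seen hc subset_rfl haU)
  have h3 : ∀ v ∈ S, 3 ≤ (G.seen S c v).card := by
    intro v hv
    have aux : ∀ x y : V, x ∈ S → y ∈ S → x ≠ y → G.Adj v x → G.Adj v y →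
        3 ≤ (G.seen S c v).card := by
      intro x y hx hy hxy hvx hvy
      have := card_le_card_seen (G := G) hc (T := {v, x, y}) (v := v)
        (by intro w; simp; rintro (rfl | rfl | rfl) <;> assumption)
        (by intro w; simp; rintro (rfl | rfl | rfl) <;> simp [*])
      rwa [Finset.card_eq_three.2 ⟨v, x, y, hvx.ne, hvy.ne, hxy, rfl⟩] at this
    rcases (hmemS v).1 hv with rfl | rfl | rfl | rfl | rfl
    · simp [hsa]
    · exact aux a s (by simp [hmemS]) (by simp [hmemS]) has.ne hab.symm hbs
    · exact aux a b (by simp [hmemS]) (by simp [hmemS]) hab.ne has.symm hbs.symm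
    · exact aux a b (by simp [hmemS]) (by simp [hmemS]) hab.ne hat.symm hbt.symm
    · refine aux a m (by simp [hmemS]) ?_ ?_ hak.symm hkm
      · rw [hmemS]; tauto
      · rintro rfl; grind
  have h4 : ∀ u ∈ S, ∀ v ∈ S, G.Adj u v → 4 ≤ (G.seen S c u ∪ G.seen S c v).card := by
    intro u hu v hv huv
    have hfive : 4 ≤ (Finset.univ : Finset (Fin 5)).card := by simp
    by_cases hua : u = a
    · rw [hua, hsa]
      exact hfive.trans (Finset.card_le_card Finset.subset_union_left)
    by_cases hva : v = a
    · rw [hva, hsa]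
      exact hfive.trans (Finset.card_le_card Finset.subset_union_right)
    have hau : G.Adj a u := (haU u hu).resolve_left hua
    -- An edge `uv` away from `a` sees `a`, `u` and `v`; one further neighbour `w` gives the fourth
    -- colour.
    have aux : ∀ w ∈ S, w ≠ a → w ≠ u → w ≠ v → (G.Adj u w ∨ G.Adj v w) →
        4 ≤ (G.seen S c u ∪ G.seen S c v).card := by
      intro w hw hwa hwu hwv hadj
      have h4 : ({a, u, v, w} : Finset V).card = 4 := by
        have : [a, u, v, w].Nodup := by
          simp [Ne.symm hua, Ne.symm hva, hwa.symm, hwu.symm, hwv.symm, huv.ne]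
        simpa using List.toFinset_card_of_nodup this
      have := card_le_card_seen_union (G := G) hc (T := {a, u, v, w}) (u := u) (v := v)
        (by
          intro x; simp only [Finset.mem_insert, Finset.mem_singleton]
          rintro (rfl | rfl | rfl | rfl)
          · simp [hmemS]
          all_goals assumption)
        (by
          intro x; simp only [Finset.mem_insert, Finset.mem_singleton]
          rintro (rfl | rfl | rfl | rfl)
          · exact Or.inl (Or.inr hau.symm)
          · exact Or.inl (Or.inl rfl)
          · exact Or.inr (Or.inl rfl)
          · tauto)
      omega
    have hb : b ∈ S := by simp [hmemS]
    have hs : s ∈ S := by simp [hmemS]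
    have ht : t ∈ S := by simp [hmemS]
    have hku := hk u hu
    have hkv := hk v hv
    have hba := hab.ne.symm
    have hsa := has.ne.symm
    have hta := hat.ne.symm
    have h1 := G.adj_comm s t
    have h2 := G.adj_comm s b
    have h3 := G.adj_comm t b
    have h4 := G.adj_comm u v
    have h5 := aux b hb hba
    have h6 := aux s hs hsa
    have h7 := aux t ht hta
    rw [hmemS] at hu hv
    grind
  refine ⟨c, fun i j hij h => ?_, fun i j hij => h3 i hij.1, fun i j hij => h3 j hij.2.1,
    fun i j hij => h4 i hij.1 j hij.2.1 (hfr.2.2 i j hij), fun x hx y hy z hz hxy hyz hxz => ?_⟩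
  · have := hc hij.1 hij.2.1 h
    have h1 := hij.2.2.1
    rw [this] at h1
    omega
  · have hmain : x = a ∨ y = a ∨ z = a := by
      have hkx := hk x hx
      have hky := hk y hy
      have hkz := hk z hz
      have h1 := G.adj_comm s t
      have h2 := G.adj_comm x y
      have h3 := G.adj_comm y z
      have h4 := G.adj_comm x z
      have h5 := hxy.ne
      have h6 := hyz.ne
      have h7 := hxz.ne
      rw [hmemS] at hx hy hz
      grind
    rcases hmain with rfl | rfl | rfl <;> ext <;> simp [hsa]

/-- The third ear stands on an edge of the quadrilateral. Since `s` and `t` are not adjacent, one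
end of this edge is `a` or `b`, and that end is common to all three triangles. -/
lemma IsTriangulation.exists_isFrame_five [Fintype V] [DecidableEq V] {f : V → ℕ}
    (h : G.IsTriangulation f) (hV : 5 ≤ Fintype.card V) :
    ∃ S, G.IsFrame f S ∧ (∃ c, G.IsGoodColouring f S c) ∧ ∀ v ∈ S, G.InTriangle v := by
  obtain ⟨a, b, s, t, hfr, hn, hab, has, hbs, hat, hbt, hst⟩ := h.exists_isFrame_four (by omega)
  obtain ⟨w, hw⟩ : ∃ w, w ∉ ({a, b, s, t} : Finset V) := by
    by_contra! hcon
    have h4 := Finset.card_le_four (a := a) (b := b) (c := s) (d := t)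
    rw [Finset.eq_univ_iff_forall.2 hcon, Finset.card_univ] at h4
    omega
  obtain ⟨i, j, k, he⟩ := h.exists_ear hfr hw
  have hfr' := he.isFrame_insert h.1.1 hfr
  have hk := he.notMem
  have hi := he.consecutive.1
  have hj := he.consecutive.2.1
  have hnb : ∀ w ∈ ({a, b, s, t} : Finset V), G.Adj k w → w = i ∨ w = j := fun w hw hkw =>
    he.eq_or_eq_of_adj h.1 hw hkw
  obtain ⟨p, q, hpq, hp⟩ : ∃ p q, ((i = p ∧ j = q) ∨ (i = q ∧ j = p)) ∧ (p = a ∨ p = b) := by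
    by_cases h1 : i = a ∨ i = b
    · exact ⟨i, j, Or.inl ⟨rfl, rfl⟩, h1⟩
    by_cases h2 : j = a ∨ j = b
    · exact ⟨j, i, Or.inr ⟨rfl, rfl⟩, h2⟩
    exfalso
    simp only [Finset.mem_insert, Finset.mem_singleton] at hi hj
    have h3 := he.adj
    have h4 := h3.ne
    have h5 := G.adj_comm s t
    grind
  have hkp : G.Adj k p := by
    rcases hpq with ⟨rfl, rfl⟩ | ⟨rfl, rfl⟩
    exacts [he.adj_left.symm, he.adj_right]
  have hkq : G.Adj k q := by
    rcases hpq with ⟨rfl, rfl⟩ | ⟨rfl, rfl⟩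
    exacts [he.adj_right, he.adj_left.symm]
  have hpqa : G.Adj p q := by
    rcases hpq with ⟨rfl, rfl⟩ | ⟨rfl, rfl⟩
    exacts [he.adj, he.adj.symm]
  have hnb' : ∀ w ∈ ({a, b, s, t} : Finset V), G.Adj k w → w = p ∨ w = q := by
    intro w hw hkw
    have := hnb w hw hkw
    grind
  have hq : q ∈ ({a, b, s, t} : Finset V) := by
    rcases hpq with ⟨rfl, rfl⟩ | ⟨rfl, rfl⟩ <;> assumption
  have hne := hpqa.ne
  have hka : k ≠ a := fun h => hk (by simp [h])
  have hkb : k ≠ b := fun h => hk (by simp [h])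
  have hks : k ≠ s := fun h => hk (by simp [h])
  have hkt : k ≠ t := fun h => hk (by simp [h])
  have hst' : s ≠ t := by rintro rfl; simp at hn
  have hnbk : ∀ w ∈ insert k ({a, b, s, t} : Finset V), G.Adj k w → w = p ∨ w = q :=
    fun w hw hkw => (Finset.mem_insert.1 hw).elim (fun h => (hkw.ne h.symm).elim)
      fun hw => hnb' w hw hkw
  simp only [Finset.mem_insert, Finset.mem_singleton] at hq
  refine ⟨_, hfr', ?_, ?_⟩
  · rcases hp with rfl | rfl
    · refine isGoodColouring_of_pentagon ?_ ?_ hfr' hab has hbs hat hbt hst hkp.symm hkq ?_ hnbk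
      · simp [hab.ne, has.ne, hbs.ne, hat.ne, hbt.ne, hst', hka.symm, hkb.symm, hks.symm, hkt.symm]
      · intro w
        simp only [Finset.mem_insert, Finset.mem_singleton]
        rw [or_comm]
        simp only [or_assoc]
      · exact hq.resolve_left hne.symm
    · refine isGoodColouring_of_pentagon ?_ ?_ hfr' hab.symm hbs has hbt hat hst hkp.symm hkq ?_ hnbk
      · simp [hab.ne.symm, has.ne, hbs.ne, hat.ne, hbt.ne, hst', hka.symm, hkb.symm, hks.symm,
          hkt.symm]
      · intro w
        simp only [Finset.mem_insert, Finset.mem_singleton]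
        rw [or_comm, or_left_comm]
        simp only [or_assoc]
      · rcases hq with h | h | h
        exacts [Or.inl h, (hne h.symm).elim, Or.inr h]
  · intro v hv
    simp only [Finset.mem_insert, Finset.mem_singleton] at hv
    rcases hv with rfl | rfl | rfl | rfl | rfl
    · exact ⟨p, q, hkp, hpqa, hkq⟩
    · exact ⟨b, s, hab, hbs, has⟩
    · exact ⟨a, s, hab.symm, has, hbs⟩
    · exact ⟨a, b, has.symm, hab, hbs.symm⟩
    · exact ⟨a, b, hat.symm, hab, hbt.symm⟩

lemma IsTriangulation.exists_isGoodColouring [Fintype V] [DecidableEq V] {f : V → ℕ}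
    (h : G.IsTriangulation f) (hV : 5 ≤ Fintype.card V) :
    (∃ c, G.IsGoodColouring f Finset.univ c) ∧ ∀ v, G.InTriangle v := by
  have key : ∀ n, ∀ S : Finset V, Fintype.card V - S.card = n → G.IsFrame f S →
      (∃ c, G.IsGoodColouring f S c) → (∀ v ∈ S, G.InTriangle v) →
      (∃ c, G.IsGoodColouring f Finset.univ c) ∧ ∀ v, G.InTriangle v := by
    intro n
    induction n with
    | zero =>
      intro S hn _ hc ht
      have hS : S = Finset.univ := Finset.eq_univ_of_card S
        (le_antisymm (Finset.card_le_univ S) (by omega))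
      subst hS
      exact ⟨hc, fun v => ht v (by simp)⟩
    | succ n ih =>
      rintro S hn hS ⟨c, hc⟩ ht
      obtain ⟨w, hw⟩ : ∃ w, w ∉ S := by
        by_contra! hcon
        rw [Finset.eq_univ_iff_forall.2 hcon, Finset.card_univ] at hn
        omega
      obtain ⟨i, j, k, he⟩ := h.exists_ear hS hw
      refine ih (insert k S) ?_ (he.isFrame_insert h.1.1 hS) (hc.exists_insert h.1 he) ?_
      · rw [Finset.card_insert_of_notMem he.notMem]; omega
      · intro v hv
        rcases Finset.mem_insert.1 hv with rfl | hv
        · exact ⟨i, j, he.adj_left.symm, he.adj, he.adj_right⟩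
        · exact ht v hv
  obtain ⟨S, hS, hc, ht⟩ := h.exists_isFrame_five hV
  exact key _ S rfl hS hc ht

/-! ### Guards from the smallest colour class. -/

/-- In a triangulated polygon with `n ≥ 5` vertices there is a set of `⌊n / 5⌋` vertices such that
each triangle has a vertex in the closed neighbourhood of this set. -/
theorem IsTriangulation.exists_guards [Fintype V] {f : V → ℕ} (h : G.IsTriangulation f)
    (hV : 5 ≤ Fintype.card V) :
    ∃ F : Finset V, F.card = Fintype.card V / 5 ∧ ∀ x y z, G.Adj x y → G.Adj y z → G.Adj x z →
      ∃ p ∈ F, ∃ u, (u = x ∨ u = y ∨ u = z) ∧ (p = u ∨ G.Adj u p) := by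
  classical
  obtain ⟨⟨c, hc⟩, -⟩ := h.exists_isGoodColouring hV
  obtain ⟨e, he⟩ : ∃ e, (Finset.univ.filter fun v => c v = e).card ≤ Fintype.card V / 5 := by
    by_contra! hcon
    have h1 : Fintype.card V = ∑ e, (Finset.univ.filter fun v => c v = e).card := by
      rw [← Finset.card_univ]
      exact Finset.card_eq_sum_card_fiberwise fun _ _ => Finset.mem_coe.2 (Finset.mem_univ _)
    have h2 : ∑ _e : Fin 5, (Fintype.card V / 5 + 1) ≤
        ∑ e, (Finset.univ.filter fun v => c v = e).card :=
      Finset.sum_le_sum fun e _ => hcon e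
    simp at h2
    omega
  -- The class may be smaller than `n / 5`; it is padded to the exact size.
  obtain ⟨F, hF, hcard⟩ := Finset.exists_superset_card_eq he (Nat.div_le_self _ _)
  refine ⟨F, hcard, fun x y z hxy hyz hxz => ?_⟩
  have hmem : e ∈ G.seen Finset.univ c x ∪ G.seen Finset.univ c y ∪ G.seen Finset.univ c z := by
    rw [hc.eq_univ x (by simp) y (by simp) z (by simp) hxy hyz hxz]; simp
  simp only [Finset.mem_union, mem_seen] at hmem
  have hpF : ∀ p, c p = e → p ∈ F := fun p hp => hF (by simp [hp])
  rcases hmem with (⟨p, -, hp, hpe⟩ | ⟨p, -, hp, hpe⟩) | ⟨p, -, hp, hpe⟩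
  · exact ⟨p, hpF p hpe, x, by simp, hp⟩
  · exact ⟨p, hpF p hpe, y, by simp, hp⟩
  · exact ⟨p, hpF p hpe, z, by simp, hp⟩

/-- A maximal outerplanar graph is a triangulated polygon. -/
theorem IsMaximalOuterplanar.exists_isTriangulation [Fintype V] (hG : G.IsMaximalOuterplanar) :
    ∃ f, G.IsTriangulation f := by
  classical
  obtain ⟨l, -, hl, hc⟩ := hG.1.noTriad.exists_nonCrossing Finset.univ
  obtain ⟨f, hf⟩ : ∃ f, G.IsNonCrossing f := ⟨_, hc.isNonCrossing (by simpa using hl)⟩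
  refine ⟨f, hf, fun u v huv hadj => ?_⟩
  by_contra! hcon
  have huv' : u ≠ v := by rintro rfl; omega
  -- A chord crossed by no edge could be added without destroying the crossing-free order, contrary
  -- to maximality.
  refine hG.2 u v huv' hadj (IsNonCrossing.isOuterplanar (f := f) ⟨hf.1, ?_⟩)
  intro a b c d hab hbc hcd hac hbd
  simp only [sup_adj, edge_adj] at hac hbd
  rcases hac with hac | ⟨⟨rfl, rfl⟩ | ⟨rfl, rfl⟩, -⟩ <;>
    rcases hbd with hbd | ⟨⟨rfl, rfl⟩ | ⟨rfl, rfl⟩, -⟩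
  · exact hf.2 a b c d hab hbc hcd hac hbd
  · have := hcon c a hac.symm hbc hcd; omega
  · omega
  · have := hcon b d hbd hab hbc; omega
  all_goals omega

theorem edist_le_one {u v : V} (h : v = u ∨ G.Adj u v) : G.edist u v ≤ 1 := by
  rcases h with rfl | h
  · simp
  · exact (edist_eq_one_iff_adj.2 h).le

/-- The upper bound for guarding and domination at distance two. -/
theorem IsMaximalOuterplanar.exists_guardingSet [Fintype V] (hG : G.IsMaximalOuterplanar)
    (hV : 5 ≤ Fintype.card V) :
    ∃ F : Finset V, F.card = Fintype.card V / 5 ∧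
      (∀ d : PlaneDrawing G, d.IsGuardingSet 2 F) ∧ G.IsDistDominatingSet 2 F := by
  classical
  obtain ⟨f, hf⟩ := hG.exists_isTriangulation
  obtain ⟨F, hF, hguard⟩ := hf.exists_guards hV
  refine ⟨F, hF, fun d a b c habc => ?_, fun u _ => ?_⟩
  · obtain ⟨p, hp, x, hx, hxp⟩ := hguard a b c habc.1 habc.2.1 habc.2.2.1
    refine ⟨p, hp, x, hx, (add_le_add_left (edist_le_one hxp) 1).trans ?_⟩
    norm_num
  -- The vertex `u` lies in a triangle; the guarded vertex `x` of it is within one step of `u`, and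
  -- the guard within one step of `x`.
  · obtain ⟨y, z, h1, h2, h3⟩ := (hf.exists_isGoodColouring hV).2 u
    obtain ⟨p, hp, x, hx, hxp⟩ := hguard u y z h1 h2 h3
    have hux : x = u ∨ G.Adj u x := by
      rcases hx with rfl | rfl | rfl
      exacts [Or.inl rfl, Or.inr h1, Or.inr h3]
    refine ⟨p, hp, (SimpleGraph.edist_triangle (v := x)).trans
      ((add_le_add (edist_le_one hux) (edist_le_one hxp)).trans ?_)⟩
    norm_num

end SimpleGraph

/-! ### The extremal graphs. -/

namespace SimpleGraph

/-- A triangulated polygon is a maximal outerplanar graph. -/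
theorem IsTriangulation.isMaximalOuterplanar {n : ℕ} {G : SimpleGraph (Fin (n + 1))}
    (h : G.IsTriangulation Fin.val) (hpath : ∀ i : Fin n, G.Adj i.castSucc i.succ)
    (hlast : G.Adj (Fin.last n) 0) : G.IsMaximalOuterplanar := by
  refine ⟨h.1.isOuterplanar, ?_⟩
  have key : ∀ u v : Fin (n + 1), u < v → ¬ G.Adj u v →
      ¬ (G ⊔ SimpleGraph.edge u v).IsOuterplanar := by
    intro u v huv hadj ho
    obtain ⟨x, y, hxy, hux, hxv, hy⟩ := h.2 u v huv hadj
    have hle : G ≤ G ⊔ SimpleGraph.edge u v := le_sup_left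
    have huv' : (G ⊔ SimpleGraph.edge u v).Adj u v := by
      simp [edge_adj, huv.ne]
    generalize G ⊔ SimpleGraph.edge u v = H at *
    -- The boundary is a Hamiltonian cycle of the enlarged graph `H`. If `H` were outerplanar in any
    -- drawing, it would have no triad and `uv` could not cross `xy` in this order.
    have hc : Cycle.Chain H.Adj (List.finRange (n + 1) : Cycle (Fin (n + 1))) := by
      rw [List.finRange_succ, Cycle.chain_coe_cons, ← List.cons_append, ← List.finRange_succ,
        List.isChain_iff_getElem]
      intro i hi
      simp only [List.length_append, List.length_finRange, List.length_singleton] at hi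
      simp only [List.getElem_append, List.length_finRange, List.getElem_finRange]
      rcases lt_or_ge (i + 1) (n + 1) with h1 | h1
      · simp only [h1, (by omega : i < n + 1), dif_pos]
        exact hle (hpath ⟨i, by omega⟩)
      · obtain rfl : i = n := by omega
        have : (⟨i, by omega⟩ : Fin (i + 1)) = Fin.last i := rfl
        simpa [this] using hle hlast
    have hnc := ho.noTriad.nonCrossing_of_cycle (List.nodup_finRange _) hc
    have hsub : ∀ a b c d : Fin (n + 1), a < b → b < c → c < d →
        [a, b, c, d].Sublist (List.finRange (n + 1)) := by
      intro a b c d hab hbc hcd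
      have := List.map_getElem_sublist (l := List.finRange (n + 1))
        (is := [a.cast (by simp), b.cast (by simp), c.cast (by simp), d.cast (by simp)])
        (by simp; omega)
      simpa using this
    rcases hy with hy | hy
    · exact hnc y u x v (hsub _ _ _ _ hy hux hxv) (hle hxy.symm) huv'
    · exact hnc u x v y (hsub _ _ _ _ hux hxv hy) huv' (hle hxy)
  intro u v hne hadj
  rcases hne.lt_or_gt with h1 | h1
  · exact key u v h1 hadj
  · rw [edge_comm]
    exact key v u h1 fun h => hadj h.symm

/-- The edges `ab` with `a < b` of a triangulated polygon on `0, …, n - 1`: each of the blocks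
`5i, …, 5i + 4` with `i < ⌊n / 5⌋` is a triangulated pentagon in which `5i + 2` has distance at least
three from the vertices outside the block, and the remaining polygon is triangulated from `0`. -/
def BlockEdge (n a b : ℕ) : Prop :=
  a < b ∧ (b = a + 1 ∨ (a = 0 ∧ (b % 5 = 0 ∨ b % 5 = 4 ∨ 5 * (n / 5) ≤ b)) ∨
    (a % 5 = 1 ∧ b < 5 * (n / 5) ∧ (b = a + 2 ∨ b = a + 3)) ∨
    (a % 5 = 0 ∧ b = a + 4 ∧ b < 5 * (n / 5)))

/-- The triangulated polygon with the edges `BlockEdge`. -/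
def blockGraph (n : ℕ) : SimpleGraph (Fin n) where
  Adj a b := BlockEdge n a b ∨ BlockEdge n b a
  symm := ⟨fun _ _ h => h.symm⟩
  loopless := ⟨fun a h => by rcases h with h | h <;> exact lt_irrefl _ h.1⟩

lemma blockGraph_adj_of_lt {n : ℕ} {a b : Fin n} (h : (a : ℕ) < b) :
    (blockGraph n).Adj a b ↔ BlockEdge n a b :=
  or_iff_left fun h' => lt_asymm h h'.1

lemma isNonCrossing_blockGraph (n : ℕ) : (blockGraph n).IsNonCrossing Fin.val := by
  refine ⟨Fin.val_injective, fun a b c d hab hbc hcd hac hbd => ?_⟩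
  rw [blockGraph_adj_of_lt (hab.trans hbc)] at hac
  rw [blockGraph_adj_of_lt (hbc.trans hcd)] at hbd
  unfold BlockEdge at hac hbd
  omega

/-- The crossing edge depends on where the chord starts and ends: within one block it is a diagonal
of the pentagon; a chord leaving the inside of a block, or going from `0` into a later one, crosses
the base `5i, 5i + 4`; the remaining chords cross an edge from `0`. -/
lemma exists_blockEdge_crossing {n u v : ℕ} (huv : u < v) (hv : v < n)
    (h : ¬ BlockEdge n u v) : ∃ x y, x < n ∧ y < n ∧ (BlockEdge n x y ∨ BlockEdge n y x) ∧
      u < x ∧ x < v ∧ (y < u ∨ v < y) := by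
  have h1 : v ≠ u + 1 := fun e => h ⟨huv, Or.inl e⟩
  have h2 : u = 0 → v % 5 ≠ 0 ∧ v % 5 ≠ 4 ∧ v < 5 * (n / 5) := fun e => by
    by_contra hc
    exact h ⟨huv, Or.inr (Or.inl ⟨e, by omega⟩)⟩
  have h3 : u % 5 = 1 → v < 5 * (n / 5) → v ≠ u + 2 ∧ v ≠ u + 3 := fun e e' => by
    by_contra hc
    exact h ⟨huv, Or.inr (Or.inr (Or.inl ⟨e, e', by omega⟩))⟩
  have h4 : u % 5 = 0 → v < 5 * (n / 5) → v ≠ u + 4 := fun e e' e'' =>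
    h ⟨huv, Or.inr (Or.inr (Or.inr ⟨e, e'', e'⟩))⟩
  clear h
  by_cases h0 : u = 0
  · have h2 := h2 h0
    by_cases hB : v < 5
    · exact ⟨1, 4, by omega, by omega,
        Or.inl ⟨by omega, Or.inr (Or.inr (Or.inl (by omega)))⟩, by omega⟩
    · exact ⟨v - v % 5, v - v % 5 + 4, by omega, by omega,
        Or.inl ⟨by omega, Or.inr (Or.inr (Or.inr (by omega)))⟩, by omega⟩
  clear h2
  by_cases hq : 5 * (n / 5) ≤ u ∨ u % 5 = 4
  · exact ⟨u + 1, 0, by omega, by omega,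
      Or.inr ⟨by omega, Or.inr (Or.inl ⟨rfl, by omega⟩)⟩, by omega⟩
  by_cases hs : v / 5 = u / 5
  · by_cases h2 : u % 5 = 2
    · exact ⟨u + 1, u - 1, by omega, by omega,
        Or.inr ⟨by omega, Or.inr (Or.inr (Or.inl (by omega)))⟩, by omega⟩
    · exact ⟨u + 1, u + 4, by omega, by omega,
        Or.inl ⟨by omega, Or.inr (Or.inr (Or.inl (by omega)))⟩, by omega⟩
  by_cases h5 : u % 5 = 0
  · exact ⟨u + 4, 0, by omega, by omega,
      Or.inr ⟨by omega, Or.inr (Or.inl ⟨rfl, by omega⟩)⟩, by omega⟩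
  · exact ⟨u - u % 5 + 4, u - u % 5, by omega, by omega,
      Or.inr ⟨by omega, Or.inr (Or.inr (Or.inr (by omega)))⟩, by omega⟩

lemma isTriangulation_blockGraph (n : ℕ) : (blockGraph n).IsTriangulation Fin.val := by
  refine ⟨isNonCrossing_blockGraph n, fun u v huv hadj => ?_⟩
  rw [blockGraph_adj_of_lt huv] at hadj
  obtain ⟨x, y, hx, hy, hxy, h⟩ := exists_blockEdge_crossing huv v.2 hadj
  exact ⟨⟨x, hx⟩, ⟨y, hy⟩, hxy, h⟩

lemma isMaximalOuterplanar_blockGraph {n : ℕ} (hn : 5 ≤ n) :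
    (blockGraph n).IsMaximalOuterplanar := by
  obtain ⟨m, rfl⟩ : ∃ m, n = m + 1 := ⟨n - 1, by omega⟩
  refine (isTriangulation_blockGraph (m + 1)).isMaximalOuterplanar (fun i => Or.inl ?_)
    (Or.inr ?_)
  · simp [BlockEdge]
  · change BlockEdge (m + 1) 0 m
    unfold BlockEdge
    omega

lemma eq_or_adj_of_edist_le_one {V : Type*} {G : SimpleGraph V} {u v : V} (h : G.edist u v ≤ 1) :
    u = v ∨ G.Adj u v := by
  obtain ⟨w, hw⟩ := exists_walk_of_edist_ne_top (ne_top_of_le_ne_top (by simp) h)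
  rw [← hw] at h
  have hl : w.length ≤ 1 := by exact_mod_cast h
  cases w with
  | nil => exact Or.inl rfl
  | cons h1 p =>
    cases p with
    | nil => exact Or.inr h1
    | cons h2 p => simp at hl

lemma exists_adj_of_edist_le_two {V : Type*} {G : SimpleGraph V} {u v : V} (h : G.edist u v ≤ 2) :
    ∃ x, (u = x ∨ G.Adj u x) ∧ (x = v ∨ G.Adj x v) := by
  obtain ⟨w, hw⟩ := exists_walk_of_edist_ne_top (ne_top_of_le_ne_top (by simp) h)
  rw [← hw] at h
  have hl : w.length ≤ 2 := by exact_mod_cast h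
  cases w with
  | nil => exact ⟨u, Or.inl rfl, Or.inl rfl⟩
  | cons h1 p =>
    cases p with
    | nil => exact ⟨u, Or.inl rfl, Or.inr h1⟩
    | cons h2 p =>
      cases p with
      | nil => exact ⟨_, Or.inr h1, Or.inr h2⟩
      | cons h3 p => simp at hl

/-- The only neighbours of `5i + 2` are `5i + 1` and `5i + 3`, and neither of these has a neighbour
outside the block. -/
lemma div_five_eq_of_blockGraph {n : ℕ} {v x p : Fin n} (hv : (v : ℕ) % 5 = 2)
    (hvn : (v : ℕ) < 5 * (n / 5)) (hvx : v = x ∨ (blockGraph n).Adj v x)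
    (hxp : x = p ∨ (blockGraph n).Adj x p) : (p : ℕ) / 5 = v / 5 := by
  have h1 : (x : ℕ) = v ∨ (x : ℕ) = v + 1 ∨ (x : ℕ) + 1 = v := by
    rcases hvx with rfl | h | h
    · omega
    · unfold BlockEdge at h; omega
    · unfold BlockEdge at h; omega
  rcases hxp with rfl | h | h
  · omega
  · unfold BlockEdge at h; omega
  · unfold BlockEdge at h; omega

lemma div_five_le_card {n : ℕ} {D : Finset (Fin n)}
    (h : ∀ v : Fin n, (v : ℕ) % 5 = 2 → (v : ℕ) < 5 * (n / 5) → ∃ p ∈ D, (p : ℕ) / 5 = v / 5) :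
    n / 5 ≤ D.card := by
  have hsub : Finset.range (n / 5) ⊆ D.image fun p : Fin n => (p : ℕ) / 5 := by
    intro i hi
    rw [Finset.mem_range] at hi
    obtain ⟨p, hp, hpi⟩ := h ⟨5 * i + 2, by omega⟩ (by dsimp only; omega) (by dsimp only; omega)
    simp only at hpi
    exact Finset.mem_image.2 ⟨p, hp, by omega⟩
  simpa using (Finset.card_le_card hsub).trans Finset.card_image_le

/-- The lower bound for domination at distance two. -/
theorem div_five_le_card_of_isDistDominatingSet {n : ℕ} {D : Finset (Fin n)}
    (hD : (blockGraph n).IsDistDominatingSet 2 D) : n / 5 ≤ D.card := by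
  refine div_five_le_card fun v hv hvn => ?_
  by_cases hvD : v ∈ D
  · exact ⟨v, hvD, rfl⟩
  obtain ⟨p, hp, hvp⟩ := hD v hvD
  obtain ⟨x, hvx, hxp⟩ := exists_adj_of_edist_le_two hvp
  exact ⟨p, hp, div_five_eq_of_blockGraph hv hvn hvx hxp⟩

/-- The lower bound for guarding at distance two. -/
theorem div_five_le_card_of_isGuardingSet {n : ℕ} {F : Finset (Fin n)}
    (hF : (isNonCrossing_blockGraph n).drawing.IsGuardingSet 2 F) : n / 5 ≤ F.card := by
  refine div_five_le_card fun v hv hvn => ?_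
  have hn := v.2
  -- The triangle `5i + 1, 5i + 2, 5i + 3` consists of `v` and its neighbours, so a guard within one
  -- step of it is within two steps of `v`.
  have h1 : (blockGraph n).Adj ⟨v - 1, by omega⟩ v := Or.inl (by simp only [BlockEdge]; omega)
  have h2 : (blockGraph n).Adj v ⟨v + 1, by omega⟩ := Or.inl ⟨by simp, Or.inl rfl⟩
  have h3 : (blockGraph n).Adj ⟨v - 1, by omega⟩ ⟨v + 1, by omega⟩ :=
    Or.inl (by simp only [BlockEdge]; omega)
  obtain ⟨p, hp, x, hx, hxp⟩ := hF _ _ _ ((isNonCrossing_blockGraph n).isTriangle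
    (by simp; omega) (by simp) h1 h2 h3)
  have hxp' : (blockGraph n).edist x p ≤ 1 := by
    have : (blockGraph n).edist x p + 1 ≤ 1 + 1 := by
      rw [one_add_one_eq_two]; exact_mod_cast hxp
    exact (ENat.add_le_add_iff_right (by simp)).1 this
  have hvx : v = x ∨ (blockGraph n).Adj v x := by
    rcases hx with rfl | rfl | rfl
    exacts [Or.inr h1.symm, Or.inl rfl, Or.inr h2]
  exact ⟨p, hp, div_five_eq_of_blockGraph hv hvn hvx (eq_or_adj_of_edist_le_one hxp')⟩

end SimpleGraph

theorem mainTheorem2 (n : ℕ) (hn : 5 ≤ n) :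
    (∀ (V : Type*) [Fintype V] (G : SimpleGraph V), Fintype.card V = n →
      G.IsMaximalOuterplanar →
        (∀ d : PlaneDrawing G, d.IsOuterplane →
          ∃ F : Finset V, F.card = n / 5 ∧ d.IsGuardingSet 2 F) ∧
        ∃ D : Finset V, D.card = n / 5 ∧ G.IsDistDominatingSet 2 D) ∧
    IsGreatest (guardingNumbersMOP 2 n) (n / 5) ∧
    IsGreatest (dominationNumbersMOP 2 n) (n / 5) := by
  have hfin : 5 ≤ Fintype.card (Fin n) := by simpa using hn
  have hguard : ∀ (G : SimpleGraph (Fin n)) (d : PlaneDrawing G), G.IsMaximalOuterplanar →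
      d.guardingNumber 2 ≤ n / 5 := by
    intro G d hG
    obtain ⟨F, hF, h, -⟩ := hG.exists_guardingSet hfin
    exact Nat.sInf_le ⟨F, h d, by simpa using hF⟩
  have hdom : ∀ G : SimpleGraph (Fin n), G.IsMaximalOuterplanar →
      G.distDominationNumber 2 ≤ n / 5 := by
    intro G hG
    obtain ⟨F, hF, -, h⟩ := hG.exists_guardingSet hfin
    exact Nat.sInf_le ⟨F, h, by simpa using hF⟩
  have hmax := SimpleGraph.isMaximalOuterplanar_blockGraph hn
  have hnc := SimpleGraph.isNonCrossing_blockGraph n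
  obtain ⟨F, -, hFg, hFd⟩ := hmax.exists_guardingSet hfin
  refine ⟨fun V _ G hV hG => ?_, ⟨⟨SimpleGraph.blockGraph n, hnc.drawing, hmax, hnc.isOuterplane,
    le_antisymm (hguard _ _ hmax) ?_⟩, ?_⟩, ⟨⟨SimpleGraph.blockGraph n, hmax,
    le_antisymm (hdom _ hmax) ?_⟩, ?_⟩⟩
  · subst hV
    obtain ⟨F, hF, hg, hd⟩ := hG.exists_guardingSet hn
    exact ⟨fun d _ => ⟨F, hF, hg d⟩, F, hF, hd⟩
  -- In `ℕ` the infimum of the empty set is `0`, so the lower bound needs a guarding set to exist;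
  -- the one from the upper bound serves.
  · refine le_csInf ⟨_, F, hFg _, rfl⟩ ?_
    rintro m ⟨D, hD, rfl⟩
    exact SimpleGraph.div_five_le_card_of_isGuardingSet hD
  · rintro m ⟨G, d, hG, -, rfl⟩
    exact hguard G d hG
  · refine le_csInf ⟨_, F, hFd, rfl⟩ ?_
    rintro m ⟨D, hD, rfl⟩
    exact SimpleGraph.div_five_le_card_of_isDistDominatingSet hD
  · rintro m ⟨G, hG, rfl⟩
    exact hdom G hG
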